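/- **Notation.** A $d$-dimensional state is a positive semidefinite matrix $\rho\in\mathbb C^{d\times d}$ with $\operatorname{tr}\rho=1$; $S(\rho)=-\operatorname{tr}(\rho\ln\rho)$ is its von Neumann entropy and $\|A\|_1=\operatorname{tr}\sqrt{A^\dagger A}$ is the trace norm. States $\rho_1,\dots,\rho_N$ form an $\epsilon$-packing net if $\frac12\|\rho_i-\rho_j\|_1>\epsilon$ for all $i\ne j$. For a closed subgroup $G\subseteq\mathbb U(d)$ and a state $\rho$ put $\chi_0(G,\rho)=S(\mathbb E_{U}[U\rho U^\dagger])-S(\rho)$, with $U\in G$ Haar random, and let $\chi(\rho_1,\dots,\rho_N)=S\big(\frac1N\sum_x\rho_x\big)-\frac1N\sum_xS(\rho_x)$ be the Holevo information of the uniform ensemble. All integers $r,d$ below are at least $1$. **(A) Packing nets.** Let $c\ge 1000$. In each of the following cases there are a closed subgroup $G\subseteq\mathbb U(d)$, a $d$-dimensional state $\rho$ of the stated rank, and $U_1,\dots,U_N\in G$ such that the states $\rho_i=U_i\rho U_i^\dagger$ form an $\epsilon$-packing net, $\chi(\rho_1,\dots,\rho_N)\le\chi_0$, and $\chi_0=\chi_0(G,\rho)$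 and $N$ satisfy the stated bounds. * Net I: if $0<\epsilon\le 2^{-4}$ and $r<d/3$: rank $r$, $\ \chi_0/c\le\epsilon^2\ln\frac{d}{r\epsilon}$, $\ c\ln N\ge rd$. * Net II: if $0<\epsilon\le 2^{-3}$ and $d$ is even: rank $d$, $\ \chi_0/c\le\epsilon^2$, $\ c\ln N\ge d^2$. * Net III: if $0<\epsilon<1$ and $r<d(1-\epsilon)/6$: rank $r$, $\ \chi_0/c\le\ln\frac dr$, $\ c\ln N\ge rd(1-\epsilon)$. **(B) The family of net I.** Let $r<d/3$ and $0<t<1/2$. In blocks of sizes $r,r,d-2r$ let $$\rho_{t,I}=\frac1r\begin{pmatrix}(1-t^2)I_r&t\sqrt{1-t^2}\,I_r&0\\t\sqrt{1-t^2}\,I_r&t^2I_r&0\\0&0&0\end{pmatrix},$$ and for $V\in\mathbb U(d-r)$ let $\rho_{t,V}=\operatorname{diag}(I_r,V)\,\rho_{t,I}\,\operatorname{diag}(I_r,V)^\dagger$. There are $V_1,\dots,V_N\in\mathbb U(d-r)$ with $N\ge\exp(dr/54)$ and $\|\rho_{t,V_i}-\rho_{t,V_j}\|_1>t/4$ for all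 $i\neq j$; moreover, with $\chi_0=\chi_0(G,\rho_{t,I})$, $G=\{\operatorname{diag}(I_r,V):V\in\mathbb U(d-r)\}$, one has $\chi(\rho_{t,V_1},\dots,\rho_{t,V_N})\le\chi_0\le t^2\ln\frac{ed}{t^2r}$. For (C) and (D) let $Q=\operatorname{diag}(1,\dots,1,0,\dots,0)$ be of rank $r$, and for $U\in\mathbb U(d)$ let $\tau_{t,U}=\frac{1+t}{2r}UQU^\dagger+\frac{1-t}{2(d-r)}(I_d-UQU^\dagger)$ and $\chi_0=\chi_0(\mathbb U(d),\tau_{t,I})$. **(C) The family of net II.** Let $r=d/2$ and $0<t\le1$. There are $U_1,\dots,U_N\in\mathbb U(d)$ with $N\ge\exp(d^2/32)$ and $\|\tau_{t,U_i}-\tau_{t,U_j}\|_1>t/2$ for all $i\ne j$; moreover $\chi(\tau_{t,U_1},\dots,\tau_{t,U_N})\le\chi_0\le t^2$. **(D) The family of net III.** Let $t=1$, $\epsilon\in(0,1)$ and $r<d(1-\epsilon)/6$. There are $U_1,\dots,U_N\in\mathbb U(d)$ with $N\ge\exp((1-\epsilon)rd/2)$ and $\|\tau_{1,U_i}-\tau_{1,U_j}\|_1>2\epsilon$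 for all $i\ne j$; moreover $\chi(\tau_{1,U_1},\dots,\tau_{1,U_N})\le\chi_0\le\ln(d/r)$. -/

import Mathlib

open Matrix
open scoped ComplexOrder

/-- A state (density matrix): positive semidefinite of trace one. -/
def IsDensity {n : Type*} [Fintype n] (ρ : Matrix n n ℂ) : Prop :=
  ρ.PosSemidef ∧ ρ.trace = 1

open Classical in
/-- The von Neumann entropy `S(ρ) = -tr(ρ ln ρ) = -∑ λ ln λ`, the sum running over the eigenvalues
`λ` of the Hermitian matrix `ρ` with multiplicity, and `0 ln 0 = 0`
(the value `0` for non-Hermitian matrices is never used). -/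
noncomputable def vnEntropy {n : Type*} [Fintype n] [DecidableEq n] (ρ : Matrix n n ℂ) : ℝ :=
  if h : ρ.IsHermitian then ∑ i, Real.negMulLog (h.eigenvalues i) else 0

/-- The trace norm `‖A‖₁ = tr √(A† A)`: the sum of the square roots of the eigenvalues of `A† A`,
i.e. of the singular values of `A`. -/
noncomputable def traceNorm {n : Type*} [Fintype n] [DecidableEq n] (A : Matrix n n ℂ) : ℝ :=
  ∑ i, Real.sqrt ((Matrix.isHermitian_conjTranspose_mul_self A).eigenvalues i)

/-- The conjugate `U ρ U†` of `ρ` by a unitary matrix `U`. -/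
def uConj {n : Type*} [Fintype n] [DecidableEq n]
    (U : Matrix.unitaryGroup n ℂ) (ρ : Matrix n n ℂ) : Matrix n n ℂ :=
  (U : Matrix n n ℂ) * ρ * (U : Matrix n n ℂ)ᴴ

/-- The unitary group carries its Borel sigma-algebra. -/
noncomputable instance unitaryGroupMeasurableSpace {n : Type*} [Fintype n] [DecidableEq n] :
    MeasurableSpace (Matrix.unitaryGroup n ℂ) := borel _

instance unitaryGroupBorelSpace {n : Type*} [Fintype n] [DecidableEq n] :
    BorelSpace (Matrix.unitaryGroup n ℂ) := ⟨rfl⟩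

instance unitaryGroupCompactSpace {n : Type*} [Fintype n] [DecidableEq n] :
    CompactSpace (Matrix.unitaryGroup n ℂ) := by
  have hcl : IsClosed ((Matrix.unitaryGroup n ℂ : Set (Matrix n n ℂ))) := by
    have : (Matrix.unitaryGroup n ℂ : Set (Matrix n n ℂ)) = {A | A * star A = 1} := by
      ext A
      exact Matrix.mem_unitaryGroup_iff
    rw [this]
    exact isClosed_eq (by fun_prop) continuous_const
  have hsub : (Matrix.unitaryGroup n ℂ : Set (Matrix n n ℂ)) ⊆
      Set.pi Set.univ (fun _ : n => Set.pi Set.univ (fun _ : n => Metric.closedBall (0 : ℂ) 1)) := by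
    intro A hA i _ j _
    simpa using entry_norm_bound_of_unitary hA i j
  have hK : IsCompact
      (Set.pi Set.univ (fun _ : n => Set.pi Set.univ (fun _ : n => Metric.closedBall (0 : ℂ) 1))) :=
    isCompact_univ_pi fun _ => isCompact_univ_pi fun _ => isCompact_closedBall _ _
  exact isCompact_iff_compactSpace.mp (hK.of_isClosed_subset hcl hsub)

/-- The whole unitary group, as a subgroup of itself, is compact. -/
instance topSubgroupCompactSpace {n : Type*} [Fintype n] [DecidableEq n] :
    CompactSpace (⊤ : Subgroup (Matrix.unitaryGroup n ℂ)) :=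
  isCompact_iff_compactSpace.mp (by simpa using isCompact_univ)

/-- The average `E_U [U ρ U†]` over a Haar random element `U` of the compact group `G` of unitary
matrices (the Haar measure of `G` is normalized to be a probability measure). -/
noncomputable def haarAverage {n : Type*} [Fintype n] [DecidableEq n]
    (G : Subgroup (Matrix.unitaryGroup n ℂ)) [CompactSpace G] (ρ : Matrix n n ℂ) : Matrix n n ℂ :=
  Matrix.of fun i j =>
    ∫ U : G, uConj (U : Matrix.unitaryGroup n ℂ) ρ i j ∂(MeasureTheory.Measure.haarMeasure ⊤)

/-- The Holevo quantity `χ₀ = S(E_U [U ρ U†]) - S(ρ)`, with `U` Haar random in `G`. -/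
noncomputable def holevoHaar {n : Type*} [Fintype n] [DecidableEq n]
    (G : Subgroup (Matrix.unitaryGroup n ℂ)) [CompactSpace G] (ρ : Matrix n n ℂ) : ℝ :=
  vnEntropy (haarAverage G ρ) - vnEntropy ρ

/-- The Holevo information `S((1/N) ∑ ρ_x) - (1/N) ∑ S(ρ_x)` of the uniform ensemble on
`ρ_1, …, ρ_N`. -/
noncomputable def holevoInfo {n : Type*} [Fintype n] [DecidableEq n] {N : ℕ}
    (ρ : Fin N → Matrix n n ℂ) : ℝ :=
  vnEntropy ((N : ℂ)⁻¹ • ∑ x, ρ x) - (N : ℝ)⁻¹ * ∑ x, vnEntropy (ρ x)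

/-- `ρ_1, …, ρ_N` is an `ε`-packing net: `½ ‖ρ_i - ρ_j‖₁ > ε` for all `i ≠ j`. -/
def IsPackingNet {n : Type*} [Fintype n] [DecidableEq n] (ε : ℝ) {N : ℕ}
    (ρ : Fin N → Matrix n n ℂ) : Prop :=
  ∀ i j, i ≠ j → ε < 1 / 2 * traceNorm (ρ i - ρ j)

/-- There is an `ε`-packing net `ρ_1, …, ρ_N` of `d`-dimensional states of rank `k`, contained in
the orbit `{U ρ U† : U ∈ G}` of a state `ρ` under a compact group `G` of unitaries, with
`χ₀ / c ≤ X` and `c ln N ≥ L`. Here `χ₀` is the Holevo quantity of `ρ` for Haar random `U ∈ G`,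
and it bounds the Holevo information of the net itself. -/
def PackingNetExists (d k : ℕ) (ε c X L : ℝ) : Prop :=
  ∃ (G : Subgroup (Matrix.unitaryGroup (Fin d) ℂ)) (_ : CompactSpace G)
    (ρ : Matrix (Fin d) (Fin d) ℂ) (N : ℕ) (U : Fin N → G),
    IsDensity ρ ∧ ρ.rank = k ∧
    IsPackingNet ε (fun i => uConj (U i : Matrix.unitaryGroup (Fin d) ℂ) ρ) ∧
    holevoInfo (fun i => uConj (U i : Matrix.unitaryGroup (Fin d) ℂ) ρ) ≤ holevoHaar G ρ ∧
    holevoHaar G ρ / c ≤ X ∧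
    L ≤ c * Real.log N

/-- The index set of `d`-dimensional space, split into blocks of sizes `r`, `r` and `d - 2r`. -/
abbrev BlockIdx (d r : ℕ) : Type := Fin r ⊕ (Fin r ⊕ Fin (d - 2 * r))

/-- The embedding `V ↦ diag(I_r, V)` of `U(d - r)` into `U(d)`. -/
def blockEmbed (d r : ℕ) :
    Matrix.unitaryGroup (Fin r ⊕ Fin (d - 2 * r)) ℂ →* Matrix.unitaryGroup (BlockIdx d r) ℂ where
  toFun V := ⟨Matrix.fromBlocks 1 0 0 V.1, by
    have h : V.1 * star V.1 = 1 :=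
      Matrix.mem_unitaryGroup_iff.mp V.2
    rw [Matrix.star_eq_conjTranspose] at h
    rw [Matrix.mem_unitaryGroup_iff, Matrix.star_eq_conjTranspose, Matrix.fromBlocks_conjTranspose,
      Matrix.fromBlocks_multiply]
    simp [h]⟩
  map_one' := by
    apply Subtype.ext
    simp
  map_mul' V W := by
    apply Subtype.ext
    simp [Matrix.fromBlocks_multiply]

/-- The image of `U(d - r)` in `U(d)` is compact. -/
instance blockRangeCompactSpace (d r : ℕ) : CompactSpace (blockEmbed d r).range := by
  have hc : Continuous (blockEmbed d r) := by
    refine Continuous.subtype_mk ?_ _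
    exact Continuous.matrix_fromBlocks continuous_const continuous_const continuous_const
      continuous_subtype_val
  have h := isCompact_range hc
  rw [← MonoidHom.coe_range] at h
  exact isCompact_iff_compactSpace.mp h

/-- The state `ρ_{t,I}`, in blocks of sizes `r`, `r`, `d - 2r`:
`(1/r) [[(1-t²) I, t√(1-t²) I, 0], [t√(1-t²) I, t² I, 0], [0, 0, 0]]`. -/
noncomputable def rhoNet (d r : ℕ) (t : ℝ) : Matrix (BlockIdx d r) (BlockIdx d r) ℂ :=
  (((r : ℝ)⁻¹ : ℝ) : ℂ) •
    Matrix.fromBlocks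
      (((1 - t ^ 2 : ℝ) : ℂ) • (1 : Matrix (Fin r) (Fin r) ℂ))
      (Matrix.fromCols (((t * Real.sqrt (1 - t ^ 2) : ℝ) : ℂ) • 1) 0)
      (Matrix.fromRows (((t * Real.sqrt (1 - t ^ 2) : ℝ) : ℂ) • 1) 0)
      (Matrix.fromBlocks (((t ^ 2 : ℝ) : ℂ) • 1) 0 0 0)

/-- The state `ρ_{t,V} = diag(I_r, V) ρ_{t,I} diag(I_r, V)†` for `V ∈ U(d - r)`. -/
noncomputable def rhoNetU (d r : ℕ) (t : ℝ)
    (V : Matrix.unitaryGroup (Fin r ⊕ Fin (d - 2 * r)) ℂ) :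
    Matrix (BlockIdx d r) (BlockIdx d r) ℂ :=
  uConj (blockEmbed d r V) (rhoNet d r t)

/-- The projector `Q = diag(1, …, 1, 0, …, 0)` with `r` ones. -/
def projQ (d r : ℕ) : Matrix (Fin d) (Fin d) ℂ :=
  Matrix.diagonal fun i => if (i : ℕ) < r then 1 else 0

/-- The state `τ_{t,U} = (1+t)/(2r) U Q U† + (1-t)/(2(d-r)) (I - U Q U†)`. -/
noncomputable def tauNet (d r : ℕ) (t : ℝ) (U : Matrix.unitaryGroup (Fin d) ℂ) :
    Matrix (Fin d) (Fin d) ℂ :=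
  (((1 + t) / (2 * (r : ℝ)) : ℝ) : ℂ) • uConj U (projQ d r) +
    (((1 - t) / (2 * ((d : ℝ) - (r : ℝ))) : ℝ) : ℂ) • (1 - uConj U (projQ d r))

/-!
Each net is an orbit `U ρ U†` of a state under a compact group of unitaries, thinned out greedily:
if the unitaries which move `ρ` by at most `δ` in trace norm have Haar measure at most `exp (-x)`,
then fewer than `exp x` of their translates do not cover the group, so the orbit contains `exp x`
points at mutual distance more than `δ` (`exists_packing_of_measure_le`, `exists_orbit_packing`).

The exceptional set is described by an overlap `q(U) = ∑ |U i j|²`, `i ∈ S`, `j ∈ T`, of two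
coordinate subspaces. The trace norm is bounded below by pairing the difference of two states with a
contraction (`norm_trace_mul_le_traceNorm`): the reflection `2 Q - 1` in the case of projections
(`le_traceNorm_tauNet_sub`), and the swap of the first two blocks for the states `rhoNet`, where the
off-diagonal blocks differ to first order in `t` (`le_traceNorm_rhoNet_sub`).

The tail of `q` comes from the bound `E exp (θ d q) ≤ (1 - θ) ^ (-|S| |T|)` for all real `θ < 1`
(`integral_exp_overlap_le`), a comparison with Gaussian matrices. If `x` is a `d × |T|` matrix of
independent standard complex Gaussians, the right-hand side is the expectation of `exp (θ m(x))`,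
where `m(x)` is the squared length of the rows of `x` in `S`. The distribution of `x` is invariant
under `x ↦ U x`, and for fixed `x` the Haar average of `exp (θ m(U x))` depends only on the
eigenvalues of `x x†`, at most `|T|` of which are nonzero. As the columns of `U` are exchangeable,
the tangent line inequality for the exponential bounds this average below by `E exp (θ d q)` plus a
multiple of `‖x‖² - d |T|` (`le_integral_exp_rowMass`), which has Gaussian mean zero.

For the entropies, the Haar average of a state is its projection onto the commutant of the group
(`haarAverage_eq_of_invariant`), here an explicit diagonal matrix. Any finite ensemble in the orbit
has the same pairing as the Haar average with the logarithm of that matrix, so its Holevo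
information is at most `χ₀` by Gibbs' inequality (`holevoInfo_le_holevoHaar`), and the bounds on
`χ₀` are estimates of logarithms.
-/

open MeasureTheory

/-! ### Haar measure on compact matrix groups -/

section Haar

variable {G : Type*} [Group G] [TopologicalSpace G] [IsTopologicalGroup G] [MeasurableSpace G]
  [BorelSpace G] [CompactSpace G]

instance haarMeasure_top_isProbabilityMeasure :
    IsProbabilityMeasure (Measure.haarMeasure (⊤ : TopologicalSpace.PositiveCompacts G)) :=
  ⟨by simpa using Measure.haarMeasure_self (K₀ := (⊤ : TopologicalSpace.PositiveCompacts G))⟩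

/-- A compact group is unimodular: a right translate of the Haar probability measure is again a
Haar probability measure, hence equal to it by uniqueness. -/
instance haarMeasure_top_isMulRightInvariant :
    (Measure.haarMeasure (⊤ : TopologicalSpace.PositiveCompacts G)).IsMulRightInvariant := by
  refine ⟨fun g => ?_⟩
  have h2 : IsProbabilityMeasure
      (Measure.map (· * g) (Measure.haarMeasure (⊤ : TopologicalSpace.PositiveCompacts G))) :=
    Measure.isProbabilityMeasure_map (measurable_mul_const g).aemeasurable
  exact Measure.isHaarMeasure_eq_of_isProbabilityMeasure _ _

end Haar

section UnitaryGroup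

variable {n : Type*} [Fintype n] [DecidableEq n]

instance secondCountableTopology_unitaryGroup :
    SecondCountableTopology (unitaryGroup n ℂ) := by
  have : SecondCountableTopology (Matrix n n ℂ) :=
    inferInstanceAs (SecondCountableTopology (n → n → ℂ))
  exact inferInstanceAs (SecondCountableTopology ((unitaryGroup n ℂ : Set (Matrix n n ℂ))))

lemma continuous_unitaryGroup_apply (i j : n) :
    Continuous fun U : unitaryGroup n ℂ => (U : Matrix n n ℂ) i j :=
  (continuous_apply_apply i j).comp continuous_subtype_val

end UnitaryGroup

/-! ### Greedy packings in compact groups -/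

/-- If the set `B` has Haar measure at most `p` in a compact group, there are at least `1 / p` group
elements none of which lies in a left translate of `B` by an earlier one: as long as `m * p < 1`,
the `m` translates chosen so far do not cover the group. -/
lemma exists_packing_of_measure_le {G : Type*} [Group G] [TopologicalSpace G]
    [IsTopologicalGroup G] [MeasurableSpace G] [BorelSpace G] [CompactSpace G] (B : Set G) {p : ℝ}
    (hp : 0 < p)
    (hB : (Measure.haarMeasure (⊤ : TopologicalSpace.PositiveCompacts G)).real B ≤ p) :
    ∃ (N : ℕ) (U : Fin N → G), 1 / p ≤ N ∧ ∀ i j, i < j → (U i)⁻¹ * U j ∉ B := by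
  set μ := Measure.haarMeasure (⊤ : TopologicalSpace.PositiveCompacts G)
  have key : ∀ m : ℕ, ((m : ℝ) - 1) * p < 1 →
      ∃ U : Fin m → G, ∀ i j, i < j → (U i)⁻¹ * U j ∉ B := by
    intro m
    induction m with
    | zero => exact fun _ => ⟨Fin.elim0, fun i => i.elim0⟩
    | succ m ih =>
      intro hm
      push_cast at hm
      obtain ⟨U, hU⟩ := ih (by nlinarith)
      have hlt : μ.real (⋃ i, (fun g => (U i)⁻¹ * g) ⁻¹' B) < 1 := by
        calc μ.real (⋃ i, (fun g => (U i)⁻¹ * g) ⁻¹' B)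
            ≤ ∑ i, μ.real ((fun g => (U i)⁻¹ * g) ⁻¹' B) := measureReal_iUnion_fintype_le _
          _ = ∑ _i : Fin m, μ.real B := by
              refine Finset.sum_congr rfl fun i _ => ?_
              simp only [measureReal_def, measure_preimage_mul]
          _ = m * μ.real B := by simp
          _ ≤ m * p := by gcongr
          _ < 1 := by linarith
      obtain ⟨g, hg⟩ : ∃ g, g ∉ ⋃ i, (fun g => (U i)⁻¹ * g) ⁻¹' B := by
        by_contra! h
        rw [Set.eq_univ_of_forall h, probReal_univ] at hlt
        exact lt_irrefl _ hlt
      simp only [Set.mem_iUnion, Set.mem_preimage, not_exists] at hg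
      refine ⟨Fin.snoc U g, fun i j hij => ?_⟩
      induction j using Fin.lastCases with
      | last =>
        obtain ⟨i, rfl⟩ := Fin.exists_castSucc_eq.mpr hij.ne
        simpa using hg i
      | cast j =>
        obtain ⟨i, rfl⟩ := Fin.exists_castSucc_eq.mpr (hij.trans (Fin.castSucc_lt_last j)).ne
        simpa using hU i j (by simpa using hij)
  obtain ⟨U, hU⟩ := key ⌈1 / p⌉₊ (by
    have := Nat.ceil_lt_add_one (show 0 ≤ 1 / p by positivity)
    calc ((⌈1 / p⌉₊ : ℝ) - 1) * p < (1 / p) * p := by gcongr; linarith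
      _ = 1 := by field_simp)
  exact ⟨_, U, Nat.le_ceil _, hU⟩

/-! ### Gaussian integrals over complex coordinates -/

section Gaussian

variable {ι : Type*} [Fintype ι]

lemma integrable_exp_neg_sum_mul_norm_sq {b : ι → ℝ} (hb : ∀ p, 0 < b p) :
    Integrable fun x : ι → ℂ => Real.exp (-∑ p, b p * ‖x p‖ ^ 2) := by
  have h : ∀ p, Integrable fun z : ℂ => Real.exp (-b p * ‖z‖ ^ 2) := fun p => by
    have h1 := GaussianFourier.integral_rexp_neg_mul_sq_norm (V := ℂ) (hb p)
    refine Integrable.of_integral_ne_zero ?_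
    rw [h1]
    have := hb p
    positivity
  have := Integrable.fintype_prod (μ := fun _ : ι => (volume : Measure ℂ)) h
  refine this.congr (Filter.Eventually.of_forall fun x => ?_)
  simp only [← Real.exp_sum, neg_mul, Finset.sum_neg_distrib]

lemma integral_exp_neg_sum_mul_norm_sq {b : ι → ℝ} (hb : ∀ p, 0 < b p) :
    ∫ x : ι → ℂ, Real.exp (-∑ p, b p * ‖x p‖ ^ 2) = ∏ p, Real.pi / b p := by
  have h := integral_fintype_prod_volume_eq_prod (fun (p : ι) (z : ℂ) =>
    Real.exp (-b p * ‖z‖ ^ 2))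
  have h1 : ∀ p, ∫ z : ℂ, Real.exp (-b p * ‖z‖ ^ 2) = Real.pi / b p := fun p => by
    rw [GaussianFourier.integral_rexp_neg_mul_sq_norm (V := ℂ) (hb p)]
    simp
  simp only [h1] at h
  rw [← h]
  simp only [← Real.exp_sum, neg_mul, Finset.sum_neg_distrib]

lemma integral_norm_sq_mul_exp_neg_norm_sq :
    ∫ z : ℂ, ‖z‖ ^ 2 * Real.exp (-‖z‖ ^ 2) = Real.pi := by
  have h := Complex.integral_rpow_mul_exp_neg_mul_rpow (p := 2) (q := 2) (b := 1)
    (by norm_num) (by norm_num) (by norm_num)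
  norm_num at h
  exact h

variable [DecidableEq ι]

lemma hasIntegral_coord_norm_sq_mul_exp (p : ι) :
    (Integrable fun x : ι → ℂ => ‖x p‖ ^ 2 * Real.exp (-∑ q, ‖x q‖ ^ 2)) ∧
      ∫ x : ι → ℂ, ‖x p‖ ^ 2 * Real.exp (-∑ q, ‖x q‖ ^ 2) = Real.pi ^ Fintype.card ι := by
  set f : ι → ℂ → ℝ := fun q z => (if q = p then ‖z‖ ^ 2 else 1) * Real.exp (-‖z‖ ^ 2) with hf
  have hfx : ∀ x : ι → ℂ, ∏ q, f q (x q) = ‖x p‖ ^ 2 * Real.exp (-∑ q, ‖x q‖ ^ 2) := fun x => by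
    simp only [hf, Finset.prod_mul_distrib, ← Real.exp_sum, Finset.sum_neg_distrib]
    simp
  have hint : ∀ q, ∫ z : ℂ, f q z = Real.pi := fun q => by
    by_cases h : q = p
    · simpa [hf, h] using integral_norm_sq_mul_exp_neg_norm_sq
    · have := GaussianFourier.integral_rexp_neg_mul_sq_norm (V := ℂ) one_pos
      simpa [hf, h] using this
  have hI : ∀ q, Integrable (f q) := fun q =>
    Integrable.of_integral_ne_zero (by rw [hint]; exact Real.pi_ne_zero)
  constructor
  · exact (Integrable.fintype_prod (μ := fun _ : ι => (volume : Measure ℂ)) hI).congr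
      (Filter.Eventually.of_forall hfx)
  · have h := integral_fintype_prod_volume_eq_prod f
    simp only [hint, hfx] at h
    simpa using h

end Gaussian

section UnitaryInvariance

/-- The squared lengths of the rows of a matrix are the diagonal entries of its Gram matrix. -/
lemma sum_norm_sq_row {n κ : Type*} [Fintype κ] (A : Matrix n κ ℂ) (i : n) :
    ((∑ j, ‖A i j‖ ^ 2 : ℝ) : ℂ) = (A * Aᴴ) i i := by
  simp [Matrix.mul_apply, Complex.mul_conj']

lemma sum_norm_sq_eq_trace {n κ : Type*} [Fintype n] [Fintype κ] (A : Matrix n κ ℂ) :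
    ((∑ i, ∑ j, ‖A i j‖ ^ 2 : ℝ) : ℂ) = (A * Aᴴ).trace := by
  rw [Complex.ofReal_sum]
  exact Finset.sum_congr rfl fun i _ => sum_norm_sq_row A i

variable {n κ : Type*} [Fintype n]

/-- Left multiplication of an `n × κ` matrix, given by the family of its entries, by a matrix. -/
def leftMul (A : Matrix n n ℂ) : (n × κ → ℂ) →ₗ[ℝ] (n × κ → ℂ) where
  toFun x p := ∑ l, A p.1 l * x (l, p.2)
  map_add' x y := by ext p; simp [mul_add, Finset.sum_add_distrib]
  map_smul' c x := by
    ext p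
    simp only [Pi.smul_apply, RingHom.id_apply, Finset.smul_sum, Complex.real_smul]
    exact Finset.sum_congr rfl fun l _ => by ring

lemma leftMul_apply (A : Matrix n n ℂ) (x : n × κ → ℂ) (i : n) (j : κ) :
    leftMul A x (i, j) = (A * (Matrix.of fun l j => x (l, j) : Matrix n κ ℂ)) i j := rfl

lemma leftMul_leftMul (A B : Matrix n n ℂ) (x : n × κ → ℂ) :
    leftMul A (leftMul B x) = leftMul (A * B) x := by
  ext ⟨i, j⟩
  have : (Matrix.of fun l j => leftMul B x (l, j) : Matrix n κ ℂ)
    = B * (Matrix.of fun l j => x (l, j) : Matrix n κ ℂ) := rfl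
  rw [leftMul_apply, this, leftMul_apply, Matrix.mul_assoc]

variable [DecidableEq n] [Fintype κ]

lemma sum_norm_sq_leftMul (U : unitaryGroup n ℂ) (x : n × κ → ℂ) :
    ∑ p, ‖leftMul (U : Matrix n n ℂ) x p‖ ^ 2 = ∑ p, ‖x p‖ ^ 2 := by
  have key : ∀ A : Matrix n κ ℂ, ∑ i, ∑ j, ‖((U : Matrix n n ℂ) * A) i j‖ ^ 2
      = ∑ i, ∑ j, ‖A i j‖ ^ 2 := fun A => by
    have hU : (U : Matrix n n ℂ)ᴴ * U = 1 := Unitary.coe_star_mul_self U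
    rw [← Complex.ofReal_inj, sum_norm_sq_eq_trace, sum_norm_sq_eq_trace,
      Matrix.conjTranspose_mul, Matrix.trace_mul_comm, Matrix.mul_assoc, ← Matrix.mul_assoc _ _ A,
      hU, Matrix.one_mul, Matrix.trace_mul_comm]
  rw [Fintype.sum_prod_type, Fintype.sum_prod_type]
  exact key (Matrix.of fun l j => x (l, j))

/-- Lebesgue measure is invariant under left multiplication by a unitary matrix: a linear map scales
it by a constant, which is `1` because the Gaussian integral is preserved. -/
lemma measurePreserving_leftMul [DecidableEq κ] (U : unitaryGroup n ℂ) :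
    MeasurePreserving (leftMul (κ := κ) (U : Matrix n n ℂ)) := by
  have hinv : ∀ x : n × κ → ℂ, leftMul ((U⁻¹ : unitaryGroup n ℂ) : Matrix n n ℂ)
      (leftMul (U : Matrix n n ℂ) x) = x := fun x => by
    rw [leftMul_leftMul, ← Submonoid.coe_mul, inv_mul_cancel]
    ext ⟨i, j⟩
    rw [leftMul_apply]
    simp
  have hinj : Function.Injective (leftMul (κ := κ) (U : Matrix n n ℂ)) :=
    Function.LeftInverse.injective hinv
  have hdet : LinearMap.det (leftMul (κ := κ) (U : Matrix n n ℂ)) ≠ 0 := by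
    have := LinearEquiv.isUnit_det' (LinearEquiv.ofInjectiveEndo _ hinj)
    exact this.ne_zero
  have hmap := Measure.map_linearMap_addHaar_eq_smul_addHaar
    (volume : Measure (n × κ → ℂ)) hdet
  have hmeas : Measurable (leftMul (κ := κ) (U : Matrix n n ℂ)) :=
    (LinearMap.continuous_of_finiteDimensional _).measurable
  refine ⟨hmeas, ?_⟩
  rw [hmap]
  have h1 : ∫ x : n × κ → ℂ, Real.exp (-∑ p, ‖x p‖ ^ 2)
        ∂(Measure.map (leftMul (U : Matrix n n ℂ)) volume)
      = ∫ x : n × κ → ℂ, Real.exp (-∑ p, ‖x p‖ ^ 2) := by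
    rw [integral_map hmeas.aemeasurable (Continuous.aestronglyMeasurable (by fun_prop))]
    simp only [sum_norm_sq_leftMul]
  have h2 := integral_exp_neg_sum_mul_norm_sq (ι := n × κ) (b := fun _ => 1) (fun _ => one_pos)
  simp only [one_mul, div_one] at h2
  rw [hmap, integral_smul_measure, h2, smul_eq_mul, mul_eq_right₀ (by positivity)] at h1
  rw [ENNReal.toReal_ofReal (abs_nonneg _)] at h1
  rw [h1]
  simp

end UnitaryInvariance

/-! ### Overlap of coordinate subspaces under a Haar random unitary -/

section Overlap

variable {n : Type*} [Fintype n] [DecidableEq n]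

/-- The column permutation of a unitary matrix. -/
def permCols (e : Equiv.Perm n) (U : unitaryGroup n ℂ) : unitaryGroup n ℂ :=
  ⟨(U : Matrix n n ℂ).submatrix id e, by
    have h : (U : Matrix n n ℂ) * (U : Matrix n n ℂ)ᴴ = 1 := Unitary.coe_mul_star_self U
    rw [mem_unitaryGroup_iff, star_eq_conjTranspose, conjTranspose_submatrix,
      submatrix_mul_equiv, h, submatrix_id_id]⟩

lemma mul_permCols (e : Equiv.Perm n) (U V : unitaryGroup n ℂ) :
    U * permCols e V = permCols e (U * V) := by
  ext i j
  simp [permCols, Matrix.mul_apply]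

/-- A Hermitian matrix whose rank is at most the size of `T` can be diagonalized with all nonzero
eigenvalues at positions in `T`. -/
lemma exists_unitary_diagonal_supported {H : Matrix n n ℂ} (hH : H.IsHermitian) (T : Finset n)
    (hT : H.rank ≤ T.card) :
    ∃ (A : unitaryGroup n ℂ) (l : n → ℝ), (∀ i ∉ T, l i = 0) ∧
      H = A * diagonal (fun i => (l i : ℂ)) * (A : Matrix n n ℂ)ᴴ := by
  classical
  set s : Finset n := Finset.univ.filter fun i => hH.eigenvalues i ≠ 0
  have hs : s.card ≤ T.card := by
    rw [hH.rank_eq_card_non_zero_eigs, Fintype.card_subtype] at hT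
    exact hT
  obtain ⟨T', hsT', hT'⟩ := Finset.exists_superset_card_eq hs (Finset.card_le_univ T)
  let e : {x // x ∈ T} ≃ {x // x ∈ T'} := Finset.equivOfCardEq hT'.symm
  refine ⟨permCols e.extendSubtype hH.eigenvectorUnitary,
    fun i => hH.eigenvalues (e.extendSubtype i), fun i hi => ?_, ?_⟩
  · by_contra h
    exact e.extendSubtype_not_mem i hi (hsT' (by simpa [s] using h))
  · have h := hH.spectral_theorem
    rw [Unitary.conjStarAlgAut_apply] at h
    have h2 : (diagonal fun i => (hH.eigenvalues (e.extendSubtype i) : ℂ))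
        = (diagonal (RCLike.ofReal ∘ hH.eigenvalues : n → ℂ)).submatrix
          e.extendSubtype e.extendSubtype := by
      rw [submatrix_diagonal_equiv]
      rfl
    rw [h2]
    simp only [permCols]
    rw [submatrix_mul_equiv, conjTranspose_submatrix, submatrix_mul_equiv, submatrix_id_id]
    exact h

/-- The squared length of the part of column `l` of `U` in the rows in `S`. -/
noncomputable def colMass (S : Finset n) (U : unitaryGroup n ℂ) (l : n) : ℝ :=
  ∑ i ∈ S, ‖(U : Matrix n n ℂ) i l‖ ^ 2

/-- The overlap `tr (P_S U P_T U†)` of the coordinate subspace of `S` with the image under `U` of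
the coordinate subspace of `T`, written as a sum over matrix entries. -/
noncomputable def overlap (S T : Finset n) (U : unitaryGroup n ℂ) : ℝ :=
  ∑ l ∈ T, colMass S U l

lemma continuous_colMass (S : Finset n) (l : n) : Continuous fun U => colMass S U l := by
  unfold colMass
  exact continuous_finsetSum _ fun i _ => (continuous_unitaryGroup_apply i l).norm.pow 2

lemma continuous_overlap (S T : Finset n) : Continuous (overlap S T) :=
  continuous_finsetSum _ fun l _ => continuous_colMass S l

lemma colMass_permCols (S : Finset n) (e : Equiv.Perm n) (U : unitaryGroup n ℂ) (l : n) :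
    colMass S (permCols e U) l = colMass S U (e l) := rfl

lemma integrable_of_continuous_unitaryGroup {f : unitaryGroup n ℂ → ℝ} (hf : Continuous f) :
    Integrable f (Measure.haarMeasure ⊤) :=
  hf.integrable_of_hasCompactSupport (HasCompactSupport.of_compactSpace f)

/-- The columns in `T` are exchangeable under the Haar measure, also when weighted by a function of
the overlap. -/
lemma integral_exp_overlap_mul_colMass (S T : Finset n) (c : ℝ) {l l' : n} (hl : l ∈ T)
    (hl' : l' ∈ T) :
    ∫ U, Real.exp (c * overlap S T U) * colMass S U l ∂(Measure.haarMeasure ⊤)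
      = ∫ U, Real.exp (c * overlap S T U) * colMass S U l' ∂(Measure.haarMeasure ⊤) := by
  set e : Equiv.Perm n := Equiv.swap l l'
  have hov : ∀ U, overlap S T (permCols e U) = overlap S T U := fun U => by
    simp only [overlap, colMass_permCols]
    refine Finset.sum_equiv e (fun i => ?_) (fun _ _ => rfl)
    rcases eq_or_ne i l with rfl | h1
    · simp [e, hl, hl']
    rcases eq_or_ne i l' with rfl | h2
    · simp [e, hl, hl']
    · simp [e, Equiv.swap_apply_of_ne_of_ne h1 h2]
  have h := integral_mul_right_eq_self (μ := Measure.haarMeasure ⊤)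
    (fun U => Real.exp (c * overlap S T U) * colMass S U l) (permCols e (1 : unitaryGroup n ℂ))
  rw [← h]
  simp only [mul_permCols, mul_one, hov, colMass_permCols]
  simp [e]

/-- The averaged exponential of the row masses of `U x`, for a fixed `n × κ` matrix `x`, lies above
its linearization in `‖x‖²` at the value `d |T|` which `‖x‖²` has on average for Gaussian `x`. The
matrix `x` enters only through the eigenvalues `l i` of `x x†`, at most `|κ|` of which are nonzero;
as the columns of `U` are exchangeable, only their sum `‖x‖²` matters in the linearization. -/
lemma le_integral_exp_rowMass {κ : Type*} [Fintype κ] (S T : Finset n)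
    (hT : T.card = Fintype.card κ) (θ : ℝ) {l₀ : n} (hl₀ : l₀ ∈ T) (x : n × κ → ℂ) :
    (∫ U, Real.exp (θ * Fintype.card n * overlap S T U) ∂(Measure.haarMeasure ⊤))
        + θ * (∫ U, Real.exp (θ * Fintype.card n * overlap S T U) * colMass S U l₀
            ∂(Measure.haarMeasure ⊤))
          * (∑ p, ‖x p‖ ^ 2 - Fintype.card n * T.card)
      ≤ ∫ U : unitaryGroup n ℂ,
          Real.exp (θ * ∑ i ∈ S, ∑ j, ‖leftMul (U : Matrix n n ℂ) x (i, j)‖ ^ 2)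
          ∂(Measure.haarMeasure ⊤) := by
  set μ : Measure (unitaryGroup n ℂ) := Measure.haarMeasure ⊤
  set d : ℝ := (Fintype.card n : ℝ)
  set X : Matrix n κ ℂ := Matrix.of fun l j => x (l, j) with hX
  obtain ⟨A, l, hl, hA⟩ := exists_unitary_diagonal_supported
    (isHermitian_mul_conjTranspose_self X) T (by
      rw [rank_self_mul_conjTranspose, hT]
      exact rank_le_card_width X)
  have hrow : ∀ U : unitaryGroup n ℂ, ∑ i ∈ S, ∑ j, ‖leftMul (U : Matrix n n ℂ) x (i, j)‖ ^ 2
      = ∑ m ∈ T, l m * colMass S (U * A) m := fun U => by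
    have h1 : ∀ i, ∑ j, ‖leftMul (U : Matrix n n ℂ) x (i, j)‖ ^ 2
        = ∑ m, l m * ‖((U * A : unitaryGroup n ℂ) : Matrix n n ℂ) i m‖ ^ 2 := fun i => by
      rw [← Complex.ofReal_inj]
      have h2 := sum_norm_sq_row ((U : Matrix n n ℂ) * X) i
      have h3 : (U : Matrix n n ℂ) * X * ((U : Matrix n n ℂ) * X)ᴴ
          = ((U * A : unitaryGroup n ℂ) : Matrix n n ℂ) * diagonal (fun i => (l i : ℂ))
            * ((U * A : unitaryGroup n ℂ) : Matrix n n ℂ)ᴴ := by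
        rw [Matrix.conjTranspose_mul, Matrix.mul_assoc, ← Matrix.mul_assoc X, hA,
          Submonoid.coe_mul, Matrix.conjTranspose_mul]
        simp only [Matrix.mul_assoc]
      rw [h3] at h2
      refine h2.trans ?_
      rw [Matrix.mul_apply]
      simp only [Matrix.mul_diagonal, conjTranspose_apply, Complex.ofReal_sum, Complex.ofReal_mul,
        Complex.ofReal_pow, ← Complex.mul_conj', Complex.star_def]
      exact Finset.sum_congr rfl fun m _ => by ring
    simp only [h1, colMass, Finset.mul_sum]
    rw [Finset.sum_comm]
    refine (Finset.sum_subset (Finset.subset_univ T) fun m _ hm => ?_).symm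
    simp [hl m hm]
  have htr : ∑ p, ‖x p‖ ^ 2 = ∑ m ∈ T, l m := by
    rw [← Complex.ofReal_inj, Fintype.sum_prod_type]
    refine (sum_norm_sq_eq_trace X).trans ?_
    have hAA : (A : Matrix n n ℂ)ᴴ * A = 1 := Unitary.coe_star_mul_self A
    rw [hA, Matrix.trace_mul_comm, ← Matrix.mul_assoc, hAA, Matrix.one_mul, trace_diagonal,
      Complex.ofReal_sum]
    refine (Finset.sum_subset (Finset.subset_univ T) fun m _ hm => ?_).symm
    simp [hl m hm]
  simp only [hrow]
  rw [integral_mul_right_eq_self (μ := μ)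
    (fun U => Real.exp (θ * ∑ m ∈ T, l m * colMass S U m)) A, htr]
  have hcm := fun m => continuous_colMass S m
  have hco := continuous_overlap S T
  have hterm : ∀ m ∈ T, ∫ U, Real.exp (θ * d * overlap S T U) * colMass S U m ∂μ
      = ∫ U, Real.exp (θ * d * overlap S T U) * colMass S U l₀ ∂μ := fun m hm =>
    integral_exp_overlap_mul_colMass S T _ hm hl₀
  have hlin : ∫ U, (Real.exp (θ * d * overlap S T U)
        + θ * ∑ m ∈ T, (l m - d) * (Real.exp (θ * d * overlap S T U) * colMass S U m)) ∂μ
      = (∫ U, Real.exp (θ * d * overlap S T U) ∂μ)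
        + θ * (∫ U, Real.exp (θ * d * overlap S T U) * colMass S U l₀ ∂μ)
          * (∑ m ∈ T, l m - d * T.card) := by
    rw [integral_add (integrable_of_continuous_unitaryGroup (by fun_prop))
      (integrable_of_continuous_unitaryGroup (by fun_prop)), integral_const_mul,
      integral_finsetSum _ fun m _ => integrable_of_continuous_unitaryGroup (by fun_prop)]
    simp only [integral_const_mul]
    rw [Finset.sum_congr rfl fun m hm => by rw [hterm m hm], ← Finset.sum_mul,
      Finset.sum_sub_distrib]
    simp
    ring
  rw [← hlin]
  refine integral_mono (integrable_of_continuous_unitaryGroup (by fun_prop))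
    (integrable_of_continuous_unitaryGroup (by fun_prop)) fun U => ?_
  -- The exponential lies above its tangent line at `θ d q(U)`.
  have hexp : ∀ a b : ℝ, Real.exp b * (1 + (a - b)) ≤ Real.exp a := fun a b => by
    have := Real.add_one_le_exp (a - b)
    calc Real.exp b * (1 + (a - b)) ≤ Real.exp b * Real.exp (a - b) := by gcongr; linarith
      _ = Real.exp a := by rw [← Real.exp_add]; ring_nf
  refine le_of_eq_of_le ?_ (hexp (θ * ∑ m ∈ T, l m * colMass S U m) (θ * d * overlap S T U))
  simp only [overlap, sub_mul, Finset.sum_sub_distrib, Finset.mul_sum, mul_add, mul_sub, mul_one]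
  congr 2
  · exact Finset.sum_congr rfl fun m _ => by ring
  · exact Finset.sum_congr rfl fun m _ => by ring

end Overlap

section OverlapTail

variable {n : Type*} [Fintype n] [DecidableEq n]

/-- The moment generating function of the overlap of two coordinate subspaces under a Haar random
unitary is at most the one of `|S||T|` squared moduli of independent standard complex Gaussians. -/
lemma integral_exp_overlap_le (S T : Finset n) (hT : T.Nonempty) {θ : ℝ} (hθ : θ < 1) :
    ∫ U, Real.exp (θ * Fintype.card n * overlap S T U) ∂(Measure.haarMeasure ⊤)
      ≤ ((1 - θ) ^ (S.card * T.card))⁻¹ := by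
  obtain ⟨l₀, hl₀⟩ := hT
  set μ : Measure (unitaryGroup n ℂ) := Measure.haarMeasure ⊤
  set κ := {x // x ∈ T}
  have hκ : T.card = Fintype.card κ := by simp [κ]
  set b : n × κ → ℝ := fun p => if p.1 ∈ S then 1 - θ else 1 with hb
  have hb0 : ∀ p, 0 < b p := fun p => by
    simp only [hb]
    split_ifs <;> linarith
  set h : (n × κ → ℂ) → ℝ := fun x => Real.exp (-∑ p, b p * ‖x p‖ ^ 2) with hh
  have hsplit : ∀ x : n × κ → ℂ,
      h x = Real.exp (θ * ∑ i ∈ S, ∑ j, ‖x (i, j)‖ ^ 2) * Real.exp (-∑ p, ‖x p‖ ^ 2) := fun x => by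
    have h1 : ∀ i, ∑ j, b (i, j) * ‖x (i, j)‖ ^ 2 = ∑ j, ‖x (i, j)‖ ^ 2
        - if i ∈ S then θ * ∑ j, ‖x (i, j)‖ ^ 2 else 0 := fun i => by
      simp only [hb]
      split_ifs
      · rw [← Finset.mul_sum]; ring
      · simp
    rw [hh, ← Real.exp_add]
    simp only [Fintype.sum_prod_type, h1, Finset.sum_sub_distrib, Finset.sum_ite_mem,
      Finset.univ_inter, Finset.mul_sum]
    congr 1
    ring
  -- The Gaussian integral of the exponential of the row masses of `U x`, for each fixed `U`.
  have hZ : ∀ U : unitaryGroup n ℂ, ∫ x : n × κ → ℂ, h (leftMul (U : Matrix n n ℂ) x)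
      = Real.pi ^ (Fintype.card (n × κ)) * ((1 - θ) ^ (S.card * T.card))⁻¹ := fun U => by
    have hmp := measurePreserving_leftMul (κ := κ) U
    have h2 := integral_map (μ := volume) hmp.measurable.aemeasurable (f := h)
      (Continuous.aestronglyMeasurable (by simp only [hh]; fun_prop))
    rw [hmp.map_eq] at h2
    rw [← h2, integral_exp_neg_sum_mul_norm_sq hb0, Finset.prod_div_distrib, div_eq_mul_inv]
    congr 2
    · simp
    · simp only [Fintype.prod_prod_type, hb]
      rw [Finset.prod_comm]
      simp [κ, pow_mul]
  have hcont : Continuous fun z : (n × κ → ℂ) × unitaryGroup n ℂ =>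
      h (leftMul (z.2 : Matrix n n ℂ) z.1) := by
    have h3 : ∀ p, Continuous fun z : (n × κ → ℂ) × unitaryGroup n ℂ =>
        leftMul (z.2 : Matrix n n ℂ) z.1 p := fun p =>
      continuous_finsetSum _ fun l _ => ((continuous_unitaryGroup_apply p.1 l).comp
        continuous_snd).mul ((continuous_apply (l, p.2)).comp continuous_fst)
    simp only [hh]
    fun_prop
  have hint : Integrable (Function.uncurry fun (x : n × κ → ℂ) (U : unitaryGroup n ℂ) =>
      h (leftMul (U : Matrix n n ℂ) x)) (volume.prod μ) := by
    set β : ℝ := 1 - max θ 0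
    have hβ : 0 < β := by
      simp only [β, sub_pos, max_lt_iff]
      exact ⟨hθ, one_pos⟩
    have hbβ : ∀ p, β ≤ b p := fun p => by
      simp only [hb, β]
      have h1 := le_max_left θ 0
      have h2 := le_max_right θ 0
      split_ifs <;> linarith
    have hdom : Integrable (fun z : (n × κ → ℂ) × unitaryGroup n ℂ =>
        Real.exp (-∑ p, β * ‖z.1 p‖ ^ 2)) (volume.prod μ) :=
      (integrable_exp_neg_sum_mul_norm_sq (ι := n × κ) fun _ => hβ).comp_fst μ
    refine hdom.mono' hcont.aestronglyMeasurable (Filter.Eventually.of_forall fun z => ?_)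
    simp only [Function.uncurry, hh, Real.norm_eq_abs, Real.abs_exp]
    rw [← Finset.mul_sum, ← sum_norm_sq_leftMul z.2, Finset.mul_sum]
    gcongr with p
    exact hbβ p
  set M := ∫ U, Real.exp (θ * Fintype.card n * overlap S T U) ∂μ with hM
  set C := ∫ U, Real.exp (θ * Fintype.card n * overlap S T U) * colMass S U l₀ ∂μ with hC
  have hpt : ∀ x : n × κ → ℂ,
      (M - θ * C * (Fintype.card n * T.card)) * Real.exp (-∑ p, ‖x p‖ ^ 2)
        + θ * C * ∑ p, ‖x p‖ ^ 2 * Real.exp (-∑ q, ‖x q‖ ^ 2)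
      ≤ ∫ U, h (leftMul (U : Matrix n n ℂ) x) ∂μ := fun x => by
    have h4 := le_integral_exp_rowMass S T hκ θ hl₀ x
    simp only [hsplit, sum_norm_sq_leftMul]
    rw [integral_mul_const]
    refine le_of_eq_of_le ?_ (mul_le_mul_of_nonneg_right h4 (Real.exp_nonneg _))
    rw [← Finset.sum_mul]
    ring
  have hG0 := integral_exp_neg_sum_mul_norm_sq (ι := n × κ) (b := fun _ => 1) fun _ => one_pos
  have hG0i := integrable_exp_neg_sum_mul_norm_sq (ι := n × κ) (b := fun _ => 1) fun _ => one_pos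
  simp only [one_mul, div_one, Finset.prod_const, Finset.card_univ] at hG0 hG0i
  have hG2 := fun p => hasIntegral_coord_norm_sq_mul_exp (ι := n × κ) p
  have hfin := integral_mono (μ := volume)
    ((hG0i.const_mul _).add ((integrable_finsetSum _ fun p _ => (hG2 p).1).const_mul _))
    hint.integral_prod_left hpt
  simp only [Pi.add_apply] at hfin
  rw [integral_add (hG0i.const_mul _)
    ((integrable_finsetSum _ fun p _ => (hG2 p).1).const_mul _), integral_const_mul,
    integral_const_mul, integral_finsetSum _ fun p _ => (hG2 p).1, hG0,
    Finset.sum_congr rfl fun p _ => (hG2 p).2] at hfin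
  have hswap := integral_integral_swap hint
  simp only [Function.uncurry] at hfin
  rw [hswap] at hfin
  simp only [hZ, integral_const, probReal_univ, one_smul, Finset.sum_const, Finset.card_univ,
    nsmul_eq_mul] at hfin
  have hpi : 0 < Real.pi ^ Fintype.card (n × κ) := by positivity
  refine le_of_mul_le_mul_left ?_ hpi
  refine le_of_eq_of_le ?_ hfin
  rw [Fintype.card_prod, ← hκ]
  push_cast
  ring

/-- Chernoff bound for the upper tail of the overlap. -/
lemma measure_le_overlap_le (S T : Finset n) (hT : T.Nonempty) {θ : ℝ} (hθ0 : 0 ≤ θ) (hθ : θ < 1)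
    (x : ℝ) :
    (Measure.haarMeasure ⊤).real {U | x ≤ overlap S T U}
      ≤ Real.exp (-(θ * Fintype.card n * x + S.card * T.card * Real.log (1 - θ))) := by
  have h := ProbabilityTheory.measure_ge_le_exp_mul_mgf (μ := Measure.haarMeasure ⊤)
    (X := overlap S T) (t := θ * Fintype.card n) x (by positivity)
    (integrable_of_continuous_unitaryGroup (by have := continuous_overlap S T; fun_prop))
  refine h.trans ((mul_le_mul_of_nonneg_left (integral_exp_overlap_le S T hT hθ)
    (Real.exp_nonneg _)).trans_eq ?_)
  rw [neg_add, Real.exp_add, ← Nat.cast_mul, Real.exp_neg (((S.card * T.card : ℕ) : ℝ) * _),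
    Real.exp_nat_mul, Real.exp_log (by linarith), neg_mul]

/-- Chernoff bound for the lower tail of the overlap. -/
lemma measure_overlap_le_le (S T : Finset n) (hT : T.Nonempty) {θ : ℝ} (hθ : θ ≤ 0) (x : ℝ) :
    (Measure.haarMeasure ⊤).real {U | overlap S T U ≤ x}
      ≤ Real.exp (-(θ * Fintype.card n * x + S.card * T.card * Real.log (1 - θ))) := by
  have h := ProbabilityTheory.measure_le_le_exp_mul_mgf (μ := Measure.haarMeasure ⊤)
    (X := overlap S T) (t := θ * Fintype.card n) x
    (mul_nonpos_of_nonpos_of_nonneg hθ (by positivity))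
    (integrable_of_continuous_unitaryGroup (by have := continuous_overlap S T; fun_prop))
  refine h.trans ((mul_le_mul_of_nonneg_left (integral_exp_overlap_le S T hT (by linarith))
    (Real.exp_nonneg _)).trans_eq ?_)
  rw [neg_add, Real.exp_add, ← Nat.cast_mul, Real.exp_neg (((S.card * T.card : ℕ) : ℝ) * _),
    Real.exp_nat_mul, Real.exp_log (by linarith), neg_mul]

end OverlapTail

/-! ### Unitary conjugation, trace norm and entropy -/

section Spectral

variable {n m : Type*} [Fintype n] [DecidableEq n] [Fintype m] [DecidableEq m]

lemma uConj_mul (U V : unitaryGroup n ℂ) (ρ : Matrix n n ℂ) :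
    uConj (U * V) ρ = uConj U (uConj V ρ) := by
  simp only [uConj, Submonoid.coe_mul, conjTranspose_mul, Matrix.mul_assoc]

lemma uConj_one (ρ : Matrix n n ℂ) : uConj 1 ρ = ρ := by
  simp [uConj]

lemma uConj_sub (U : unitaryGroup n ℂ) (ρ σ : Matrix n n ℂ) :
    uConj U (ρ - σ) = uConj U ρ - uConj U σ := by
  simp only [uConj, Matrix.mul_sub, Matrix.sub_mul]

lemma uConj_add (U : unitaryGroup n ℂ) (ρ σ : Matrix n n ℂ) :
    uConj U (ρ + σ) = uConj U ρ + uConj U σ := by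
  simp only [uConj, Matrix.mul_add, Matrix.add_mul]

lemma uConj_smul (U : unitaryGroup n ℂ) (c : ℂ) (ρ : Matrix n n ℂ) :
    uConj U (c • ρ) = c • uConj U ρ := by
  simp only [uConj, Matrix.mul_smul, Matrix.smul_mul]

lemma conjTranspose_mul_coe (U : unitaryGroup n ℂ) : (U : Matrix n n ℂ)ᴴ * U = 1 :=
  Unitary.coe_star_mul_self U

lemma uConj_matrix_one (U : unitaryGroup n ℂ) : uConj U (1 : Matrix n n ℂ) = 1 := by
  have h : (U : Matrix n n ℂ) * (U : Matrix n n ℂ)ᴴ = 1 := Unitary.coe_mul_star_self U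
  rw [uConj, Matrix.mul_one, h]

lemma uConj_mul_uConj (U : unitaryGroup n ℂ) (A B : Matrix n n ℂ) :
    uConj U A * uConj U B = uConj U (A * B) := by
  simp only [uConj]
  rw [Matrix.mul_assoc, ← Matrix.mul_assoc _ (_ * B), ← Matrix.mul_assoc _ _ B,
    conjTranspose_mul_coe, Matrix.one_mul]
  simp only [Matrix.mul_assoc]

lemma conjTranspose_uConj (U : unitaryGroup n ℂ) (A : Matrix n n ℂ) :
    (uConj U A)ᴴ = uConj U Aᴴ := by
  simp only [uConj, conjTranspose_mul, conjTranspose_conjTranspose, Matrix.mul_assoc]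

lemma trace_uConj (U : unitaryGroup n ℂ) (A : Matrix n n ℂ) : (uConj U A).trace = A.trace := by
  rw [uConj, Matrix.trace_mul_comm, ← Matrix.mul_assoc, conjTranspose_mul_coe, Matrix.one_mul]

lemma charpoly_uConj (U : unitaryGroup n ℂ) (A : Matrix n n ℂ) :
    (uConj U A).charpoly = A.charpoly := by
  rw [uConj, Matrix.charpoly_mul_comm, ← Matrix.mul_assoc, conjTranspose_mul_coe, Matrix.one_mul]

lemma isHermitian_uConj (U : unitaryGroup n ℂ) {A : Matrix n n ℂ} (hA : A.IsHermitian) :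
    (uConj U A).IsHermitian := by
  rw [IsHermitian, conjTranspose_uConj, hA]

lemma isDensity_uConj (U : unitaryGroup n ℂ) {ρ : Matrix n n ℂ} (hρ : IsDensity ρ) :
    IsDensity (uConj U ρ) :=
  ⟨hρ.1.mul_mul_conjTranspose_same _, (trace_uConj U ρ).trans hρ.2⟩

lemma eq_mul_diagonal_mul_conjTranspose {A : Matrix n n ℂ} (hA : A.IsHermitian) :
    A = (hA.eigenvectorUnitary : Matrix n n ℂ) * diagonal (fun i => (hA.eigenvalues i : ℂ))
      * (hA.eigenvectorUnitary : Matrix n n ℂ)ᴴ := by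
  conv_lhs => rw [hA.spectral_theorem, Unitary.conjStarAlgAut_apply]
  rfl

lemma traceNorm_eq_sum_roots (A : Matrix n n ℂ) :
    traceNorm A = ((Aᴴ * A).charpoly.roots.map fun z => √z.re).sum := by
  rw [(isHermitian_conjTranspose_mul_self A).roots_charpoly_eq_eigenvalues, Multiset.map_map]
  rfl

lemma traceNorm_uConj (U : unitaryGroup n ℂ) (A : Matrix n n ℂ) :
    traceNorm (uConj U A) = traceNorm A := by
  rw [traceNorm_eq_sum_roots, traceNorm_eq_sum_roots, conjTranspose_uConj, uConj_mul_uConj,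
    charpoly_uConj]

lemma traceNorm_reindex (e : n ≃ m) (A : Matrix n n ℂ) :
    traceNorm (reindex e e A) = traceNorm A := by
  rw [traceNorm_eq_sum_roots, traceNorm_eq_sum_roots, conjTranspose_reindex, reindex_apply,
    reindex_apply, submatrix_mul_equiv, ← reindex_apply, charpoly_reindex]

lemma traceNorm_sub_comm (A B : Matrix n n ℂ) : traceNorm (A - B) = traceNorm (B - A) := by
  rw [traceNorm_eq_sum_roots, traceNorm_eq_sum_roots, ← neg_sub B A, conjTranspose_neg,
    neg_mul_neg]

/-- The distances in an orbit of a unitary group depend only on the quotient of the unitaries. -/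
lemma traceNorm_uConj_sub_uConj (U V : unitaryGroup n ℂ) (ρ : Matrix n n ℂ) :
    traceNorm (uConj U ρ - uConj V ρ) = traceNorm (ρ - uConj (U⁻¹ * V) ρ) := by
  rw [← traceNorm_uConj U (ρ - _), uConj_sub, ← uConj_mul, mul_inv_cancel_left]

/-- Duality: the trace norm bounds the pairing with every contraction. -/
lemma norm_trace_mul_le_traceNorm (A : Matrix n n ℂ) {K : Matrix n n ℂ}
    (hK : (1 - K * Kᴴ).PosSemidef) : ‖(K * A).trace‖ ≤ traceNorm A := by
  have hA := isHermitian_conjTranspose_mul_self A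
  set V := hA.eigenvectorUnitary
  have hV : (V : Matrix n n ℂ) * (V : Matrix n n ℂ)ᴴ = 1 := Unitary.coe_mul_star_self V
  have hV' : (V : Matrix n n ℂ)ᴴ * V = 1 := conjTranspose_mul_coe V
  have htr : (K * A).trace = ∑ i, ∑ j, ((V : Matrix n n ℂ)ᴴ * K) i j * (A * V) j i := by
    calc (K * A).trace = ((V : Matrix n n ℂ)ᴴ * K * (A * V)).trace := by
          rw [Matrix.mul_assoc, Matrix.trace_mul_comm _ (K * (A * (V : Matrix n n ℂ))),
            ← Matrix.mul_assoc K, Matrix.mul_assoc (K * A), hV, Matrix.mul_one]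
      _ = _ := rfl
  have h1 : ∀ i, ∑ j, ‖((V : Matrix n n ℂ)ᴴ * K) i j‖ ^ 2 ≤ 1 := fun i => by
    have h2 := (hK.conjTranspose_mul_mul_same (V : Matrix n n ℂ)).diag_nonneg (i := i)
    rw [Matrix.mul_sub, Matrix.sub_mul, Matrix.mul_one, hV'] at h2
    have h3 : (V : Matrix n n ℂ)ᴴ * (K * Kᴴ) * V
        = ((V : Matrix n n ℂ)ᴴ * K) * ((V : Matrix n n ℂ)ᴴ * K)ᴴ := by
      simp only [conjTranspose_mul, conjTranspose_conjTranspose, Matrix.mul_assoc]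
    rw [h3, Matrix.sub_apply, one_apply_eq, ← sum_norm_sq_row] at h2
    have h4 : (0 : ℂ) ≤ ((1 - ∑ j, ‖((V : Matrix n n ℂ)ᴴ * K) i j‖ ^ 2 : ℝ) : ℂ) := by
      rw [Complex.ofReal_sub, Complex.ofReal_one]
      exact h2
    have h5 := Complex.zero_le_real.mp h4
    linarith
  have h2 : ∀ i, ∑ j, ‖(A * (V : Matrix n n ℂ)) j i‖ ^ 2 = hA.eigenvalues i := fun i => by
    have h3 := sum_norm_sq_row (A * (V : Matrix n n ℂ))ᴴ i
    rw [conjTranspose_conjTranspose, conjTranspose_mul, Matrix.mul_assoc, ← Matrix.mul_assoc Aᴴ,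
      eq_mul_diagonal_mul_conjTranspose hA] at h3
    change _ = ((V : Matrix n n ℂ)ᴴ * ((V : Matrix n n ℂ)
      * diagonal (fun i => (hA.eigenvalues i : ℂ)) * (V : Matrix n n ℂ)ᴴ * V)) i i at h3
    rw [Matrix.mul_assoc, hV', Matrix.mul_one, ← Matrix.mul_assoc, hV', Matrix.one_mul,
      diagonal_apply_eq] at h3
    rw [← Complex.ofReal_injective h3]
    exact Finset.sum_congr rfl fun j _ => by
      rw [← conjTranspose_mul, conjTranspose_apply, norm_star]
  rw [htr, traceNorm]
  refine (norm_sum_le _ _).trans (Finset.sum_le_sum fun i _ => ?_)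
  refine (norm_sum_le _ _).trans ?_
  simp only [norm_mul]
  refine (Real.sum_mul_le_sqrt_mul_sqrt _ _ _).trans ?_
  rw [h2]
  refine mul_le_of_le_one_left (Real.sqrt_nonneg _) ?_
  exact Real.sqrt_le_one.mpr (h1 i)

lemma vnEntropy_eq_sum_roots {ρ : Matrix n n ℂ} (hρ : ρ.IsHermitian) :
    vnEntropy ρ = (ρ.charpoly.roots.map fun z => Real.negMulLog z.re).sum := by
  classical
  have h := hρ.roots_charpoly_eq_eigenvalues
  rw [vnEntropy, dif_pos hρ, h, Multiset.map_map]
  congr!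

lemma vnEntropy_uConj (U : unitaryGroup n ℂ) {ρ : Matrix n n ℂ} (hρ : ρ.IsHermitian) :
    vnEntropy (uConj U ρ) = vnEntropy ρ := by
  rw [vnEntropy_eq_sum_roots (isHermitian_uConj U hρ), vnEntropy_eq_sum_roots hρ, charpoly_uConj]

lemma vnEntropy_reindex (e : n ≃ m) {ρ : Matrix n n ℂ} (hρ : ρ.IsHermitian) :
    vnEntropy (reindex e e ρ) = vnEntropy ρ := by
  have hρ' : (reindex e e ρ).IsHermitian := hρ.submatrix e.symm
  rw [vnEntropy_eq_sum_roots hρ', vnEntropy_eq_sum_roots hρ, charpoly_reindex]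

lemma vnEntropy_diagonal (w : n → ℝ) :
    vnEntropy (diagonal fun i => (w i : ℂ)) = ∑ i, Real.negMulLog (w i) := by
  have hH : (diagonal fun i => (w i : ℂ)).IsHermitian :=
    isHermitian_diagonal_of_self_adjoint _ (by ext; simp)
  have hroots : (diagonal fun i => (w i : ℂ)).charpoly.roots
      = Finset.univ.val.map fun i => (w i : ℂ) := by
    have h := Polynomial.roots_multiset_prod_X_sub_C (Finset.univ.val.map fun i => (w i : ℂ))
    rw [Multiset.map_map] at h
    rw [charpoly_diagonal]
    exact h
  rw [vnEntropy_eq_sum_roots hH, hroots, Multiset.map_map]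
  rfl

/-- The entropy of a multiple of a projection. -/
lemma vnEntropy_smul_of_idempotent {P : Matrix n n ℂ} (hP : P.IsHermitian) (hPP : P * P = P)
    (c : ℝ) : vnEntropy ((c : ℂ) • P) = -Real.log c * (c * P.trace.re) := by
  classical
  have hH : ((c : ℂ) • P).IsHermitian := by
    rw [IsHermitian, conjTranspose_smul, hP]
    simp
  have hev : ∀ i, hH.eigenvalues i * hH.eigenvalues i = c * hH.eigenvalues i := fun i => by
    set D : Matrix n n ℂ := diagonal fun i => (hH.eigenvalues i : ℂ) with hD
    have h1 : (c : ℂ) • P = uConj hH.eigenvectorUnitary D := eq_mul_diagonal_mul_conjTranspose hH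
    have h2 : uConj hH.eigenvectorUnitary (D * D) = uConj hH.eigenvectorUnitary ((c : ℂ) • D) := by
      rw [← uConj_mul_uConj, uConj_smul, ← h1, smul_mul_smul_comm, hPP, smul_smul]
    have h3 := congrArg (uConj hH.eigenvectorUnitary⁻¹) h2
    rw [← uConj_mul, ← uConj_mul, inv_mul_cancel, uConj_one, uConj_one, hD, diagonal_mul_diagonal,
      ← diagonal_smul] at h3
    have h4 := congrFun (diagonal_injective h3) i
    simp only [Pi.smul_apply, smul_eq_mul] at h4
    exact_mod_cast h4
  have htr : ∑ i, hH.eigenvalues i = c * P.trace.re := by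
    have h1 := congrArg Complex.re hH.trace_eq_sum_eigenvalues
    rw [trace_smul, smul_eq_mul, Complex.re_ofReal_mul] at h1
    rw [h1]
    simp
  rw [← htr, vnEntropy, dif_pos hH, Finset.mul_sum]
  refine Finset.sum_congr rfl fun i _ => ?_
  have h1 : hH.eigenvalues i = 0 ∨ hH.eigenvalues i = c := by
    rcases eq_or_ne (hH.eigenvalues i) 0 with h | h
    · exact Or.inl h
    · exact Or.inr (mul_right_cancel₀ h (hev i))
  have h2 : Real.negMulLog (hH.eigenvalues i) = -Real.log c * hH.eigenvalues i := by
    rcases h1 with h | h <;> rw [h]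
    · simp
    · rw [Real.negMulLog]; ring
  convert! h2

/-- Gibbs' inequality: the entropy is at most the cross entropy with a positive diagonal state. -/
lemma vnEntropy_le_crossEntropy {σ : Matrix n n ℂ} (hσ : IsDensity σ) {w : n → ℝ}
    (hw : ∀ i, 0 < w i) (hw1 : ∑ i, w i = 1) :
    vnEntropy σ ≤ -∑ j, (σ j j).re * Real.log (w j) := by
  classical
  have hH := hσ.1.isHermitian
  set V := hH.eigenvectorUnitary
  set l := hH.eigenvalues with hl
  have hl0 : ∀ i, 0 ≤ l i := fun i => hσ.1.eigenvalues_nonneg i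
  have hl1 : ∑ i, l i = 1 := by
    have h1 := hH.trace_eq_sum_eigenvalues
    rw [hσ.2] at h1
    have h2 : (1 : ℂ) = ((∑ i, l i : ℝ) : ℂ) := by rw [h1]; simp [hl]
    exact_mod_cast h2.symm
  have hrow : ∀ j, ∑ i, ‖(V : Matrix n n ℂ) j i‖ ^ 2 = 1 := fun j => by
    have h1 := sum_norm_sq_row (V : Matrix n n ℂ) j
    have hV : (V : Matrix n n ℂ) * (V : Matrix n n ℂ)ᴴ = 1 := Unitary.coe_mul_star_self V
    rw [hV, one_apply_eq] at h1
    exact_mod_cast h1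
  have hcol : ∀ i, ∑ j, ‖(V : Matrix n n ℂ) j i‖ ^ 2 = 1 := fun i => by
    have h1 := sum_norm_sq_row (V : Matrix n n ℂ)ᴴ i
    rw [conjTranspose_conjTranspose, conjTranspose_mul_coe, one_apply_eq] at h1
    simp only [conjTranspose_apply, norm_star] at h1
    exact_mod_cast h1
  have hdiag : ∀ j, (σ j j).re = ∑ i, l i * ‖(V : Matrix n n ℂ) j i‖ ^ 2 := fun j => by
    rw [← Complex.ofReal_re (∑ i, l i * ‖(V : Matrix n n ℂ) j i‖ ^ 2)]
    congr 1
    conv_lhs => rw [eq_mul_diagonal_mul_conjTranspose hH, Matrix.mul_apply]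
    simp only [Matrix.mul_diagonal, conjTranspose_apply, Complex.ofReal_sum, Complex.ofReal_mul,
      Complex.ofReal_pow, ← Complex.mul_conj', Complex.star_def]
    exact Finset.sum_congr rfl fun m _ => by ring
  have hterm : ∀ i j, Real.negMulLog (l i) + l i * Real.log (w j) ≤ w j - l i := fun i j => by
    rcases (hl0 i).eq_or_lt with h | h
    · simp [← h, (hw j).le]
    · have h1 := Real.log_le_sub_one_of_pos (div_pos (hw j) h)
      rw [Real.log_div (hw j).ne' h.ne'] at h1
      have h2 := mul_le_mul_of_nonneg_left h1 h.le
      have h3 : l i * (w j / l i - 1) = w j - l i := by field_simp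
      rw [h3] at h2
      rw [Real.negMulLog]
      linarith
  have hsum : ∑ j, ∑ i, ‖(V : Matrix n n ℂ) j i‖ ^ 2
      * (Real.negMulLog (l i) + l i * Real.log (w j)) ≤ 0 := by
    calc _ ≤ ∑ j, ∑ i, ‖(V : Matrix n n ℂ) j i‖ ^ 2 * (w j - l i) := by
          gcongr with j _ i _
          exact hterm i j
      _ = (∑ j, (∑ i, ‖(V : Matrix n n ℂ) j i‖ ^ 2) * w j)
          - ∑ i, (∑ j, ‖(V : Matrix n n ℂ) j i‖ ^ 2) * l i := by
          simp only [mul_sub, Finset.sum_sub_distrib, Finset.sum_mul]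
          rw [Finset.sum_comm (f := fun j i => ‖(V : Matrix n n ℂ) j i‖ ^ 2 * l i)]
      _ = 0 := by simp only [hrow, hcol, one_mul, hw1, hl1, sub_self]
  have hsplit : ∑ j, ∑ i, ‖(V : Matrix n n ℂ) j i‖ ^ 2
      * (Real.negMulLog (l i) + l i * Real.log (w j))
      = ∑ i, Real.negMulLog (l i) + ∑ j, (σ j j).re * Real.log (w j) := by
    simp only [mul_add, Finset.sum_add_distrib]
    congr 1
    · rw [Finset.sum_comm]
      simp only [← Finset.sum_mul, hcol, one_mul]
    · simp only [hdiag, Finset.sum_mul]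
      exact Finset.sum_congr rfl fun j _ => Finset.sum_congr rfl fun i _ => by ring
  have hS : vnEntropy σ = ∑ i, Real.negMulLog (l i) := by
    rw [vnEntropy, dif_pos hH]
  rw [hS]
  linarith

end Spectral

/-! ### Haar averages and the Holevo information of an orbit -/

section Average

variable {n : Type*} [Fintype n] [DecidableEq n]

lemma commute_of_uConj_eq {U : unitaryGroup n ℂ} {K : Matrix n n ℂ} (h : uConj U K = K) :
    (U : Matrix n n ℂ) * K = K * U := by
  conv_rhs => rw [← h, uConj, Matrix.mul_assoc, conjTranspose_mul_coe, Matrix.mul_one]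

lemma uConj_eq_of_commute {U : unitaryGroup n ℂ} {K : Matrix n n ℂ}
    (h : (U : Matrix n n ℂ) * K = K * U) : uConj U K = K := by
  have hU : (U : Matrix n n ℂ) * (U : Matrix n n ℂ)ᴴ = 1 := Unitary.coe_mul_star_self U
  rw [uConj, h, Matrix.mul_assoc, hU, Matrix.mul_one]

/-- A matrix commuting with all unitary matrices is scalar. -/
lemma exists_eq_smul_one_of_uConj_eq {K : Matrix n n ℂ} (h : ∀ U, uConj U K = K) :
    ∃ k : ℂ, K = k • 1 := by
  have hoff : ∀ i j, i ≠ j → K i j = 0 := fun i j hij => by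
    let D : unitaryGroup n ℂ := ⟨diagonal fun a => if a = i then -1 else 1, by
      rw [mem_unitaryGroup_iff, star_eq_conjTranspose, diagonal_conjTranspose,
        diagonal_mul_diagonal, ← diagonal_one]
      congr 1
      ext a
      by_cases ha : a = i <;> simp [ha]⟩
    have h1 := congrFun (congrFun (commute_of_uConj_eq (h D)) i) j
    simp only [D, diagonal_mul, mul_diagonal, if_true, if_neg hij.symm] at h1
    have h2 : (2 : ℂ) * K i j = 0 := by linear_combination -h1
    simpa using h2
  have hdiag : ∀ i j, K i i = K j j := fun i j => by
    have h1 := congrFun (congrFun (commute_of_uConj_eq (h (permCols (Equiv.swap i j) 1))) i) j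
    have hP : ∀ a b, ((permCols (Equiv.swap i j) 1 : unitaryGroup n ℂ) : Matrix n n ℂ) a b
        = if a = Equiv.swap i j b then 1 else 0 := fun a b => Matrix.one_apply
    rw [Matrix.mul_apply, Matrix.mul_apply, Finset.sum_eq_single j, Finset.sum_eq_single i] at h1
    · simpa [hP] using h1.symm
    · intro b _ hb
      rw [hP, if_neg fun h => hb (by rw [h, Equiv.swap_apply_right]), mul_zero]
    · simp
    · intro b _ hb
      rw [hP, if_neg fun h2 => hb (by
        have := congrArg (Equiv.swap i j) h2
        simpa using this.symm), zero_mul]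
    · simp
  rcases isEmpty_or_nonempty n with hn | ⟨⟨i₀⟩⟩
  · exact ⟨0, Subsingleton.elim _ _⟩
  · refine ⟨K i₀ i₀, ?_⟩
    ext i j
    rcases eq_or_ne i j with rfl | hij
    · simp [hdiag i i₀]
    · simp [hij, hoff i j hij]

variable (G : Subgroup (unitaryGroup n ℂ)) [CompactSpace G] (ρ : Matrix n n ℂ)

/-- Linear functionals commute with the Haar average. -/
lemma sum_mul_haarAverage (c : n → n → ℂ) :
    ∑ i, ∑ j, c i j * haarAverage G ρ i j
      = ∫ U : G, ∑ i, ∑ j, c i j * uConj (U : unitaryGroup n ℂ) ρ i j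
          ∂(Measure.haarMeasure ⊤) := by
  have hcont : ∀ i j, Continuous fun U : G => uConj (U : unitaryGroup n ℂ) ρ i j := fun i j => by
    have h : Continuous fun U : G => ((U : unitaryGroup n ℂ) : Matrix n n ℂ) :=
      continuous_subtype_val.comp continuous_subtype_val
    exact ((h.matrix_mul continuous_const).matrix_mul h.matrix_conjTranspose).matrix_elem i j
  have hint : ∀ f : G → ℂ, Continuous f → Integrable f (Measure.haarMeasure ⊤) := fun f hf =>
    hf.integrable_of_hasCompactSupport (HasCompactSupport.of_compactSpace f)
  rw [integral_finsetSum _ fun i _ => hint _ (by have := hcont; fun_prop)]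
  refine Finset.sum_congr rfl fun i _ => ?_
  rw [integral_finsetSum _ fun j _ => hint _ (by have := hcont; fun_prop)]
  refine Finset.sum_congr rfl fun j _ => ?_
  rw [integral_const_mul]
  rfl

lemma uConj_haarAverage {W : unitaryGroup n ℂ} (hW : W ∈ G) :
    uConj W (haarAverage G ρ) = haarAverage G ρ := by
  have hexp : ∀ (A : Matrix n n ℂ) (i j : n), uConj W A i j
      = ∑ a, ∑ b, ((W : Matrix n n ℂ) i a * star ((W : Matrix n n ℂ) j b)) * A a b := by
    intro A i j
    simp only [uConj, Matrix.mul_apply, conjTranspose_apply, Finset.sum_mul]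
    rw [Finset.sum_comm]
    exact Finset.sum_congr rfl fun a _ => Finset.sum_congr rfl fun b _ => by ring
  ext i j
  rw [hexp, sum_mul_haarAverage]
  simp only [← hexp, ← uConj_mul]
  exact integral_mul_left_eq_self (μ := Measure.haarMeasure ⊤)
    (fun U : G => uConj (U : unitaryGroup n ℂ) ρ i j) ⟨W, hW⟩

lemma trace_uConj_mul_of_invariant {U : unitaryGroup n ℂ} {K : Matrix n n ℂ}
    (hK : uConj U K = K) : (uConj U ρ * K).trace = (ρ * K).trace := by
  conv_lhs => rw [← hK, uConj_mul_uConj, trace_uConj]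

lemma trace_haarAverage_mul {K : Matrix n n ℂ} (hK : ∀ U ∈ G, uConj U K = K) :
    (haarAverage G ρ * K).trace = (ρ * K).trace := by
  have hexp : ∀ A : Matrix n n ℂ, (A * K).trace = ∑ i, ∑ j, K j i * A i j := fun A =>
    Finset.sum_congr rfl fun i _ => Finset.sum_congr rfl fun j _ => mul_comm _ _
  rw [hexp, sum_mul_haarAverage]
  simp only [← hexp]
  have h : ∀ U : G, (uConj (U : unitaryGroup n ℂ) ρ * K).trace = (ρ * K).trace := fun U =>
    trace_uConj_mul_of_invariant ρ (hK U U.2)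
  simp [h]

/-- The Haar average is the orthogonal projection onto the commutant of the group: it is the unique
element of the commutant with the same pairing as `ρ` with all elements of the commutant. -/
lemma haarAverage_eq_of_invariant {A : Matrix n n ℂ} (hA : ∀ U ∈ G, uConj U A = A)
    (htr : ∀ K, (∀ U ∈ G, uConj U K = K) → (A * K).trace = (ρ * K).trace) :
    haarAverage G ρ = A := by
  rw [← sub_eq_zero, ← trace_mul_conjTranspose_self_eq_zero_iff, Matrix.sub_mul, trace_sub,
    sub_eq_zero]
  have hK : ∀ U ∈ G, uConj U (haarAverage G ρ - A)ᴴ = (haarAverage G ρ - A)ᴴ := fun U hU => by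
    rw [← conjTranspose_uConj, uConj_sub, uConj_haarAverage G ρ hU, hA U hU]
  rw [trace_haarAverage_mul G ρ hK, htr _ hK]

/-- The Holevo information of a finite ensemble in the orbit of `ρ` is at most the one of the whole
orbit: the averages of both ensembles have the same pairing with the logarithm of the Haar average,
so Gibbs' inequality compares their entropies. -/
lemma holevoInfo_le_holevoHaar {ρ : Matrix n n ℂ} (hρ : IsDensity ρ) {w : n → ℝ}
    (hw : ∀ i, 0 < w i) (havg : haarAverage G ρ = diagonal fun i => (w i : ℂ)) {N : ℕ} (hN : 0 < N)
    (U : Fin N → unitaryGroup n ℂ) (hU : ∀ x, U x ∈ G) :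
    holevoInfo (fun x => uConj (U x) ρ) ≤ holevoHaar G ρ := by
  have hN' : (N : ℝ) ≠ 0 := by positivity
  have hNc : (N : ℂ) ≠ 0 := by exact_mod_cast hN.ne'
  have hL : ∀ V ∈ G, uConj V (diagonal fun i => (Real.log (w i) : ℂ))
      = diagonal fun i => (Real.log (w i) : ℂ) := fun V hV => by
    have h1 := commute_of_uConj_eq (havg ▸ uConj_haarAverage G ρ hV)
    refine uConj_eq_of_commute ?_
    ext i j
    have h2 := congrFun (congrFun h1 i) j
    rw [mul_diagonal, diagonal_mul] at h2 ⊢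
    rcases eq_or_ne ((V : Matrix n n ℂ) i j) 0 with h | h
    · simp [h]
    · have h3 : w j = w i := by
        have := mul_left_cancel₀ h (h2.trans (mul_comm _ _))
        exact_mod_cast this
      rw [h3, mul_comm]
  have hw1 : ∑ i, w i = 1 := by
    have h1 := trace_haarAverage_mul G ρ (K := 1) fun V _ => uConj_matrix_one V
    rw [Matrix.mul_one, Matrix.mul_one, hρ.2, havg, trace_diagonal] at h1
    exact_mod_cast h1
  set σ : Matrix n n ℂ := (N : ℂ)⁻¹ • ∑ x, uConj (U x) ρ with hσ
  have hσd : IsDensity σ := by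
    constructor
    · refine PosSemidef.smul (posSemidef_sum _ fun x _ => (isDensity_uConj _ hρ).1) ?_
      rw [← Complex.ofReal_natCast, ← Complex.ofReal_inv, Complex.zero_le_real]
      positivity
    · simp only [hσ, trace_smul, trace_sum, trace_uConj, hρ.2]
      simp [hNc]
  have hpair : (σ * diagonal fun i => (Real.log (w i) : ℂ)).trace
      = ((diagonal fun i => (w i : ℂ)) * diagonal fun i => (Real.log (w i) : ℂ)).trace := by
    rw [← havg, trace_haarAverage_mul G ρ hL, hσ, smul_mul, Matrix.sum_mul, trace_smul, trace_sum]
    simp only [fun x => trace_uConj_mul_of_invariant ρ (hL _ (hU x))]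
    simp [hNc]
  have hcross : ∑ j, (σ j j).re * Real.log (w j) = ∑ j, w j * Real.log (w j) := by
    have h1 := congrArg Complex.re hpair
    rw [diagonal_mul_diagonal, trace_diagonal] at h1
    simpa [Matrix.trace, mul_diagonal] using h1
  have hS := vnEntropy_le_crossEntropy hσd hw hw1
  rw [holevoInfo, holevoHaar, havg, vnEntropy_diagonal]
  simp only [vnEntropy_uConj _ hρ.1.isHermitian]
  rw [Finset.sum_const, Finset.card_univ, Fintype.card_fin, nsmul_eq_mul, ← mul_assoc,
    inv_mul_cancel₀ hN', one_mul]
  refine sub_le_sub_right (hS.trans_eq ?_) _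
  rw [hcross, ← Finset.sum_neg_distrib]
  exact Finset.sum_congr rfl fun j _ => by rw [Real.negMulLog]; ring

lemma haarAverage_top {ρ : Matrix n n ℂ} (hρ : IsDensity ρ) :
    haarAverage ⊤ ρ = diagonal fun _ => (((Fintype.card n : ℝ)⁻¹ : ℝ) : ℂ) := by
  have hn : (Fintype.card n : ℂ) ≠ 0 := by
    have : Nonempty n := by
      by_contra h
      rw [not_nonempty_iff] at h
      have := hρ.2
      simp [Matrix.trace] at this
    exact_mod_cast Fintype.card_ne_zero
  have hd : (diagonal fun _ => (((Fintype.card n : ℝ)⁻¹ : ℝ) : ℂ) : Matrix n n ℂ)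
      = (((Fintype.card n : ℝ)⁻¹ : ℝ) : ℂ) • 1 := by
    rw [smul_one_eq_diagonal]
  rw [hd]
  refine haarAverage_eq_of_invariant _ _ (fun U _ => by rw [uConj_smul, uConj_matrix_one])
    fun K hK => ?_
  obtain ⟨k, rfl⟩ := exists_eq_smul_one_of_uConj_eq fun U => hK U trivial
  simp [hρ.2, trace_smul, hn]

end Average

/-! ### Packings of orbits -/

/-- A packing of an orbit: if `φ V` moves `ρ` by more than `δ` in trace norm for all `V` outside a
set of Haar measure at most `exp (-x)`, then the orbit contains `exp x` points at mutual distance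
more than `δ`. -/
lemma exists_orbit_packing {H n : Type*} [Group H] [TopologicalSpace H] [IsTopologicalGroup H]
    [MeasurableSpace H] [BorelSpace H] [CompactSpace H] [Fintype n] [DecidableEq n]
    (φ : H →* unitaryGroup n ℂ) (ρ : Matrix n n ℂ) {δ x : ℝ} (B : Set H)
    (hB : (Measure.haarMeasure (⊤ : TopologicalSpace.PositiveCompacts H)).real B ≤ Real.exp (-x))
    (hfar : ∀ V ∉ B, δ < traceNorm (ρ - uConj (φ V) ρ)) :
    ∃ (N : ℕ) (V : Fin N → H), Real.exp x ≤ N ∧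
      ∀ i j, i ≠ j → δ < traceNorm (uConj (φ (V i)) ρ - uConj (φ (V j)) ρ) := by
  obtain ⟨N, V, hN, hV⟩ := exists_packing_of_measure_le B (Real.exp_pos _) hB
  rw [Real.exp_neg, one_div, inv_inv] at hN
  have hlt : ∀ i j, i < j → δ < traceNorm (uConj (φ (V i)) ρ - uConj (φ (V j)) ρ) :=
    fun i j hij => by
      rw [traceNorm_uConj_sub_uConj, ← map_inv, ← map_mul]
      exact hfar _ (hV i j hij)
  refine ⟨N, V, hN, fun i j hij => ?_⟩
  rcases hij.lt_or_gt with h | h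
  · exact hlt i j h
  · rw [traceNorm_sub_comm]
    exact hlt j i h

/-! ### States with two eigenspaces -/

section Tau

variable {d r : ℕ}

/-- The indices of the first `r` basis vectors. -/
def firstIdx (d r : ℕ) : Finset (Fin d) := Finset.univ.filter fun i => (i : ℕ) < r

lemma card_firstIdx (hrd : r ≤ d) : (firstIdx d r).card = r := by
  rw [firstIdx, Fin.card_filter_val_lt, min_eq_right hrd]

lemma firstIdx_nonempty (hr : 1 ≤ r) (hrd : r ≤ d) : (firstIdx d r).Nonempty := by
  rw [← Finset.card_pos, card_firstIdx hrd]
  exact hr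

lemma tauNet_eq_uConj (t : ℝ) (U : unitaryGroup (Fin d) ℂ) :
    tauNet d r t U = uConj U (tauNet d r t 1) := by
  simp only [tauNet, uConj_add, uConj_smul, uConj_sub, uConj_one, uConj_matrix_one]

/-- The eigenvalues of `tauNet d r t 1`. -/
noncomputable def tauWeight (d r : ℕ) (t : ℝ) (i : Fin d) : ℝ :=
  if (i : ℕ) < r then (1 + t) / (2 * r) else (1 - t) / (2 * (d - r))

lemma tauNet_one (t : ℝ) : tauNet d r t 1 = diagonal fun i => (tauWeight d r t i : ℂ) := by
  ext i j
  rcases eq_or_ne i j with rfl | hij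
  · by_cases hi : (i : ℕ) < r <;> simp [tauNet, uConj_one, projQ, tauWeight, hi]
  · simp [tauNet, uConj_one, projQ, hij]

lemma sum_ite_lt (hrd : r ≤ d) (a b : ℝ) :
    ∑ i : Fin d, (if (i : ℕ) < r then a else b) = r * a + (d - r) * b := by
  rw [Finset.sum_ite, Finset.sum_const, Finset.sum_const]
  have h1 : (Finset.univ.filter fun i : Fin d => (i : ℕ) < r).card = r := card_firstIdx hrd
  have h2 : (Finset.univ.filter fun i : Fin d => ¬ (i : ℕ) < r).card = d - r := by
    rw [Finset.filter_not, Finset.card_univ_sdiff, h1, Fintype.card_fin]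
  rw [h1, h2, nsmul_eq_mul, nsmul_eq_mul, Nat.cast_sub hrd]

lemma isDensity_tauNet (hr : 1 ≤ r) (hrd : r < d) {t : ℝ} (ht0 : 0 ≤ t) (ht1 : t ≤ 1) :
    IsDensity (tauNet d r t 1) := by
  have hr0 : (0 : ℝ) < r := by exact_mod_cast hr
  have hd0 : (0 : ℝ) < d - r := sub_pos.mpr (by exact_mod_cast hrd)
  rw [tauNet_one]
  constructor
  · refine PosSemidef.diagonal fun i => ?_
    rw [Pi.zero_apply, Complex.zero_le_real, tauWeight]
    have : 0 ≤ 1 - t := by linarith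
    split_ifs <;> positivity
  · rw [trace_diagonal, ← Complex.ofReal_sum, ← Complex.ofReal_one]
    congr 1
    simp only [tauWeight]
    rw [sum_ite_lt hrd.le]
    field_simp
    ring

lemma trace_projQ_mul_uConj (U : unitaryGroup (Fin d) ℂ) :
    (projQ d r * uConj U (projQ d r)).trace
      = (overlap (firstIdx d r) (firstIdx d r) U : ℂ) := by
  have h : ∀ i, uConj U (projQ d r) i i
      = ∑ l : Fin d,
        if (l : ℕ) < r then ((‖(U : Matrix (Fin d) (Fin d) ℂ) i l‖ ^ 2 : ℝ) : ℂ) else 0 := by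
    intro i
    rw [uConj, Matrix.mul_apply, projQ]
    refine Finset.sum_congr rfl fun l _ => ?_
    rw [mul_diagonal, conjTranspose_apply]
    split_ifs
    · rw [mul_one, Complex.star_def, Complex.mul_conj', Complex.ofReal_pow]
    · rw [mul_zero, zero_mul]
  have h2 : ∀ i, (projQ d r * uConj U (projQ d r)) i i
      = if (i : ℕ) < r then uConj U (projQ d r) i i else 0 := fun i => by
    rw [projQ, diagonal_mul, ite_mul, one_mul, zero_mul]
  simp only [Matrix.trace, diag_apply, h2, h, overlap, colMass, firstIdx, Finset.sum_filter]
  simp only [← Finset.sum_filter]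
  rw [Finset.sum_comm]
  push_cast
  rfl

lemma trace_projQ (hrd : r ≤ d) : (projQ d r).trace = r := by
  rw [projQ, trace_diagonal, Finset.sum_boole]
  exact congrArg _ (card_firstIdx hrd)

lemma projQ_mul_self : projQ d r * projQ d r = projQ d r := by
  rw [projQ, diagonal_mul_diagonal]
  simp

lemma conjTranspose_projQ : (projQ d r)ᴴ = projQ d r := by
  rw [projQ, diagonal_conjTranspose]
  congr 1
  ext i
  by_cases hi : (i : ℕ) < r <;> simp [hi]

/-- The pairing of the difference of two projections with the reflection `2 Q - 1` bounds the trace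
norm from below by the overlap. -/
lemma le_traceNorm_tauNet_sub (hrd : r ≤ d) (t : ℝ) (U : unitaryGroup (Fin d) ℂ) :
    2 * ((1 + t) / (2 * r) - (1 - t) / (2 * (d - r)))
        * (r - overlap (firstIdx d r) (firstIdx d r) U)
      ≤ traceNorm (tauNet d r t 1 - uConj U (tauNet d r t 1)) := by
  set Q := projQ d r
  set K : Matrix (Fin d) (Fin d) ℂ := (2 : ℂ) • Q - 1
  set a : ℝ := (1 + t) / (2 * r) - (1 - t) / (2 * (d - r)) with ha
  have hQ : Q * Q = Q := projQ_mul_self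
  have hK : (1 - K * Kᴴ).PosSemidef := by
    have h1 : Kᴴ = K := by
      simp only [K, conjTranspose_sub, conjTranspose_smul, Q, conjTranspose_projQ,
        conjTranspose_one]
      simp
    have h2 : K * K = 1 := by
      simp only [K, Matrix.sub_mul, Matrix.mul_sub, smul_mul, Matrix.mul_smul, hQ, Matrix.one_mul,
        Matrix.mul_one]
      module
    rw [h1, h2, sub_self]
    exact PosSemidef.zero
  have hdiff : tauNet d r t 1 - uConj U (tauNet d r t 1) = (a : ℂ) • (Q - uConj U Q) := by
    simp only [tauNet, uConj_add, uConj_smul, uConj_sub, uConj_one, uConj_matrix_one, ha,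
      Complex.ofReal_sub]
    module
  have htr : (K * ((a : ℂ) • (Q - uConj U Q))).trace
      = ((2 * a * (r - overlap (firstIdx d r) (firstIdx d r) U) : ℝ) : ℂ) := by
    simp only [K, Matrix.sub_mul, Matrix.mul_sub, smul_mul, Matrix.mul_smul, hQ, Matrix.one_mul,
      trace_smul, trace_sub, trace_uConj, smul_eq_mul]
    rw [trace_projQ_mul_uConj, trace_projQ hrd]
    push_cast
    ring
  have h := norm_trace_mul_le_traceNorm (tauNet d r t 1 - uConj U (tauNet d r t 1)) hK
  rw [hdiff, htr, Complex.norm_real, ← hdiff] at h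
  exact (le_abs_self _).trans h

lemma sum_colMass_univ {n : Type*} [Fintype n] [DecidableEq n] (U : unitaryGroup n ℂ) (l : n) :
    colMass Finset.univ U l = 1 := by
  have h := sum_norm_sq_row (U : Matrix n n ℂ)ᴴ l
  rw [conjTranspose_conjTranspose, conjTranspose_mul_coe, one_apply_eq] at h
  simp only [conjTranspose_apply, norm_star] at h
  exact_mod_cast h

lemma overlap_compl {n : Type*} [Fintype n] [DecidableEq n] (S T : Finset n)
    (U : unitaryGroup n ℂ) : overlap Sᶜ T U = T.card - overlap S T U := by
  have h : ∀ l, colMass Sᶜ U l = 1 - colMass S U l := fun l => by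
    rw [← sum_colMass_univ U l, colMass, colMass, colMass, ← Finset.sum_compl_add_sum S]
    ring
  simp [overlap, h]

lemma vnEntropy_tauNet (hrd : r ≤ d) (t : ℝ) :
    vnEntropy (tauNet d r t 1) = r * Real.negMulLog ((1 + t) / (2 * r))
      + (d - r) * Real.negMulLog ((1 - t) / (2 * (d - r))) := by
  rw [tauNet_one, vnEntropy_diagonal]
  simp only [tauWeight, apply_ite Real.negMulLog]
  exact sum_ite_lt hrd _ _

lemma holevoHaar_tauNet (hr : 1 ≤ r) (hrd : r < d) {t : ℝ} (ht0 : 0 ≤ t) (ht1 : t ≤ 1) :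
    holevoHaar ⊤ (tauNet d r t 1) = Real.log d - (r * Real.negMulLog ((1 + t) / (2 * r))
      + (d - r) * Real.negMulLog ((1 - t) / (2 * (d - r)))) := by
  have hd : (d : ℝ) ≠ 0 := by
    have : 0 < d := by omega
    positivity
  rw [holevoHaar, haarAverage_top (isDensity_tauNet hr hrd ht0 ht1), vnEntropy_diagonal,
    vnEntropy_tauNet hrd.le]
  simp [Real.negMulLog, hd]

lemma holevoInfo_tauNet_le (hr : 1 ≤ r) (hrd : r < d) {t : ℝ} (ht0 : 0 ≤ t) (ht1 : t ≤ 1)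
    {N : ℕ} (hN : 0 < N) (U : Fin N → unitaryGroup (Fin d) ℂ) :
    holevoInfo (fun i => uConj (U i) (tauNet d r t 1)) ≤ holevoHaar ⊤ (tauNet d r t 1) := by
  have hρ := isDensity_tauNet hr hrd ht0 ht1
  refine holevoInfo_le_holevoHaar ⊤ hρ (fun _ => ?_) (haarAverage_top hρ) hN U fun _ => trivial
  have : 0 < d := by omega
  rw [Fintype.card_fin]
  positivity

lemma holevoHaar_tauNet_half (hr : 1 ≤ r) (hd : d = 2 * r) {t : ℝ} (ht0 : 0 ≤ t) (ht1 : t ≤ 1) :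
    holevoHaar ⊤ (tauNet d r t 1) ≤ t ^ 2 := by
  have hr0 : (0 : ℝ) < r := by exact_mod_cast hr
  rw [holevoHaar_tauNet hr (by omega) ht0 ht1]
  have hdr : (d : ℝ) - r = r := by rw [hd]; push_cast; ring
  have hd2 : (d : ℝ) = 2 * r := by rw [hd]; push_cast; ring
  -- Both terms are estimated by `log (1 + s) ≤ s`, with `s = t` and `s = -t`; for `t = 1` the
  -- second eigenvalue is zero.
  have key : ∀ s : ℝ, -1 ≤ s →
      r * Real.negMulLog ((1 + s) / (2 * r)) ≥ (1 + s) / 2 * (Real.log d - s) := fun s hs => by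
    rcases hs.eq_or_lt with h | h
    · simp [← h]
    · have h1 : 0 < 1 + s := by linarith
      have h2 := Real.log_le_sub_one_of_pos h1
      rw [← hd2, Real.negMulLog, Real.log_div h1.ne' (by rw [hd2]; positivity)]
      have h3 : (r : ℝ) * (-((1 + s) / d) * (Real.log (1 + s) - Real.log d))
          = (1 + s) / 2 * (Real.log d - Real.log (1 + s)) := by
        rw [hd2]; field_simp; ring
      rw [h3]
      have : Real.log d - s ≤ Real.log d - Real.log (1 + s) := by linarith
      exact mul_le_mul_of_nonneg_left this (by linarith)
  rw [hdr]
  have h1 := key t (by linarith)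
  have h2 := key (-t) (by linarith)
  rw [← sub_eq_add_neg] at h2
  linarith

lemma holevoHaar_tauNet_one (hr : 1 ≤ r) (hrd : r < d) :
    holevoHaar ⊤ (tauNet d r 1 1) = Real.log (d / r) := by
  have hr0 : (0 : ℝ) < r := by exact_mod_cast hr
  have hd0 : (0 : ℝ) < d := hr0.trans (by exact_mod_cast hrd)
  rw [holevoHaar_tauNet hr hrd zero_le_one le_rfl, Real.log_div hd0.ne' hr0.ne', Real.negMulLog]
  have : (1 + 1 : ℝ) / (2 * r) = (r : ℝ)⁻¹ := by field_simp; norm_num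
  rw [this, Real.log_inv]
  simp [hr0.ne']

/-- Packing with `r = d / 2`: the projections are far apart unless the image of one of them has
overlap at most `r / 4`, half the mean, with the complement of the other. -/
lemma exists_tauNet_packing_half (hr : 1 ≤ r) (hd : d = 2 * r) {t : ℝ} (ht0 : 0 < t) :
    ∃ (N : ℕ) (U : Fin N → unitaryGroup (Fin d) ℂ), Real.exp ((d : ℝ) ^ 2 / 32) ≤ N ∧
      ∀ i j, i ≠ j →
        t / 2 < traceNorm (uConj (U i) (tauNet d r t 1) - uConj (U j) (tauNet d r t 1)) := by
  have hr0 : (0 : ℝ) < r := by exact_mod_cast hr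
  have hrd : r ≤ d := by omega
  have hdr : (d : ℝ) - r = r := by rw [hd]; push_cast; ring
  have hd2 : (d : ℝ) = 2 * r := by rw [hd]; push_cast; ring
  set S := firstIdx d r
  have hS : S.card = r := card_firstIdx hrd
  have hSc : Sᶜ.card = r := by rw [Finset.card_compl, hS, Fintype.card_fin]; omega
  refine exists_orbit_packing (MonoidHom.id _) _ {U | overlap Sᶜ S U ≤ r / 4} ?_ fun U hU => ?_
  · -- `θ = -1` is the optimal parameter for half the mean.
    refine (measure_overlap_le_le Sᶜ S (firstIdx_nonempty hr hrd) (θ := -1) (by norm_num)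
      _).trans ?_
    rw [hS, hSc, Fintype.card_fin, hd2]
    have h1 := Real.log_two_gt_d9
    have h2 : (1 : ℝ) - -1 = 2 := by norm_num
    rw [h2]
    gcongr
    nlinarith [mul_pos hr0 hr0]
  · rw [Set.mem_ofPred_eq, not_le, overlap_compl, hS] at hU
    refine lt_of_lt_of_le ?_ (le_traceNorm_tauNet_sub hrd t U)
    rw [hdr]
    have h1 : 2 * ((1 + t) / (2 * (r : ℝ)) - (1 - t) / (2 * r)) = 2 * t / r := by
      field_simp; ring
    rw [h1]
    calc t / 2 = 2 * t / r * (r / 4) := by field_simp; norm_num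
      _ < _ := by gcongr

/-- Packing with `r` small compared to `d`: the normalized projections are far apart unless their
overlap is at least `(1 - ε) r`, which is more than six times the mean. -/
lemma exists_tauNet_packing_one {ε : ℝ} (hr : 1 ≤ r) (hε0 : 0 < ε) (hε1 : ε < 1)
    (hrd : (r : ℝ) < d * (1 - ε) / 6) :
    ∃ (N : ℕ) (U : Fin N → unitaryGroup (Fin d) ℂ), Real.exp ((1 - ε) * r * d / 2) ≤ N ∧
      ∀ i j, i ≠ j →
        2 * ε < traceNorm (uConj (U i) (tauNet d r 1 1) - uConj (U j) (tauNet d r 1 1)) := by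
  have hr0 : (0 : ℝ) < r := by exact_mod_cast hr
  have hrd' : r ≤ d := by
    have h1 : (d : ℝ) * (1 - ε) ≤ d := mul_le_of_le_one_right (by positivity) (by linarith)
    have h2 : (r : ℝ) ≤ d := by linarith
    exact_mod_cast h2
  set S := firstIdx d r
  have hS : S.card = r := card_firstIdx hrd'
  refine exists_orbit_packing (MonoidHom.id _) _ {U | (1 - ε) * r ≤ overlap S S U} ?_
    fun U hU => ?_
  · -- `5 / 6` is the optimal parameter at the boundary case `d (1 - ε) = 6 r`.
    refine (measure_le_overlap_le S S (firstIdx_nonempty hr hrd') (θ := 5 / 6) (by norm_num)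
      (by norm_num) _).trans ?_
    rw [hS, Fintype.card_fin]
    have h1 : -2 < Real.log (1 - 5 / 6) := by
      rw [Real.lt_log_iff_exp_lt (by norm_num), Real.exp_neg]
      have h2 : Real.exp 2 = Real.exp 1 * Real.exp 1 := by rw [← Real.exp_add]; norm_num
      have h3 := Real.exp_one_gt_d9
      rw [inv_lt_comm₀ (Real.exp_pos _) (by norm_num), h2]
      nlinarith
    gcongr
    have h4 : (r : ℝ) * r * -2 ≤ r * r * Real.log (1 - 5 / 6) := by gcongr
    have h5 : (r : ℝ) * r ≤ r * (d * (1 - ε) / 6) := by gcongr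
    nlinarith
  · rw [Set.mem_ofPred_eq, not_le] at hU
    refine lt_of_lt_of_le ?_ (le_traceNorm_tauNet_sub hrd' 1 U)
    have h1 : 2 * ((1 + 1) / (2 * (r : ℝ)) - (1 - 1) / (2 * (d - r))) = 2 / r := by
      rw [sub_self, zero_div]; field_simp; norm_num
    rw [h1]
    calc 2 * ε = 2 / r * (r - (1 - ε) * r) := by field_simp; ring
      _ < _ := by gcongr

end Tau

/-! ### States rotated inside a block -/

lemma trace_fromBlocks_eq_add {m n R : Type*} [Fintype m] [Fintype n] [AddCommMonoid R]
    (A : Matrix m m R) (B : Matrix m n R) (C : Matrix n m R) (D : Matrix n n R) :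
    (fromBlocks A B C D).trace = A.trace + D.trace := by
  simp [Matrix.trace]

lemma trace_fromCols_mul_mul_fromRows {m n R : Type*} [Fintype m] [Fintype n] [DecidableEq m]
    [CommSemiring R] (a b : R) (X : Matrix (m ⊕ n) (m ⊕ n) R) :
    (fromCols (a • (1 : Matrix m m R)) (0 : Matrix m n R)
        * (X * fromRows (b • (1 : Matrix m m R)) (0 : Matrix n m R))).trace
      = a * b * ∑ i, X (Sum.inl i) (Sum.inl i) := by
  rw [← fromBlocks_toBlocks X, fromBlocks_mul_fromRows, fromCols_mul_fromRows]
  simp [Matrix.trace, Finset.mul_sum, mul_assoc, mul_left_comm]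

section Block

variable {d r : ℕ}

/-- The isometry whose range is the support of `rhoNet d r t`. -/
noncomputable def rhoIsometry (d r : ℕ) (t : ℝ) : Matrix (BlockIdx d r) (Fin r) ℂ :=
  fromRows ((√(1 - t ^ 2) : ℂ) • 1) (fromRows ((t : ℂ) • 1) 0)

lemma conjTranspose_rhoIsometry_mul {t : ℝ} (ht : t ^ 2 ≤ 1) :
    (rhoIsometry d r t)ᴴ * rhoIsometry d r t = 1 := by
  have h : ((√(1 - t ^ 2) : ℝ) : ℂ) * (√(1 - t ^ 2) : ℝ) + (t : ℂ) * t = 1 := by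
    rw [← Complex.ofReal_mul, ← Complex.ofReal_mul, ← Complex.ofReal_add,
      Real.mul_self_sqrt (by linarith)]
    norm_num
    ring_nf
  simp only [rhoIsometry, conjTranspose_fromRows_eq_fromCols_conjTranspose, fromCols_mul_fromRows,
    conjTranspose_smul, conjTranspose_one, conjTranspose_zero, smul_mul, Matrix.mul_smul,
    Matrix.one_mul, Matrix.mul_zero, smul_smul, Complex.star_def, Complex.conj_ofReal, add_zero]
  rw [← add_smul, h, one_smul]

lemma rhoNet_eq_smul {t : ℝ} (ht : t ^ 2 ≤ 1) :
    rhoNet d r t = (((r : ℝ)⁻¹ : ℝ) : ℂ) • (rhoIsometry d r t * (rhoIsometry d r t)ᴴ) := by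
  have h : ((√(1 - t ^ 2) : ℝ) : ℂ) * (√(1 - t ^ 2) : ℝ) = ((1 - t ^ 2 : ℝ) : ℂ) := by
    rw [← Complex.ofReal_mul, Real.mul_self_sqrt (by linarith)]
  rw [rhoNet]
  congr 1
  ext (i | i | i) (j | j | j) <;>
    simp [rhoIsometry, Matrix.mul_apply, one_apply]
  all_goals
    rcases eq_or_ne i j with rfl | hij
    · simp_all [mul_comm, sq]
    · simp [hij, hij.symm]

lemma isDensity_rhoNet (hr : 1 ≤ r) {t : ℝ} (ht : t ^ 2 ≤ 1) : IsDensity (rhoNet d r t) := by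
  have hr0 : (r : ℂ) ≠ 0 := by exact_mod_cast (by omega : r ≠ 0)
  rw [rhoNet_eq_smul ht]
  constructor
  · refine (posSemidef_self_mul_conjTranspose _).smul ?_
    rw [Complex.zero_le_real]
    positivity
  · rw [trace_smul, trace_mul_comm, conjTranspose_rhoIsometry_mul ht]
    simp [hr0]

lemma rank_rhoNet (hr : 1 ≤ r) {t : ℝ} (ht : t ^ 2 ≤ 1) : (rhoNet d r t).rank = r := by
  have hr0 : (((r : ℝ)⁻¹ : ℝ) : ℂ) ≠ 0 := by
    rw [Complex.ofReal_ne_zero]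
    positivity
  rw [rhoNet_eq_smul ht, rank_smul_of_mem_nonZeroDivisors _ (mem_nonZeroDivisors_of_ne_zero hr0),
    rank_self_mul_conjTranspose,
    ← rank_conjTranspose_mul_self, conjTranspose_rhoIsometry_mul ht, rank_one, Fintype.card_fin]

lemma vnEntropy_rhoNet (hr : 1 ≤ r) {t : ℝ} (ht : t ^ 2 ≤ 1) :
    vnEntropy (rhoNet d r t) = Real.log r := by
  have hr0 : (r : ℝ) ≠ 0 := by positivity
  set W := rhoIsometry d r t
  have hW : Wᴴ * W = 1 := conjTranspose_rhoIsometry_mul ht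
  rw [rhoNet_eq_smul ht, vnEntropy_smul_of_idempotent (isHermitian_mul_conjTranspose_self W),
    trace_mul_comm, hW, Real.log_inv]
  · simp [hr0]
  · rw [Matrix.mul_assoc, ← Matrix.mul_assoc _ W, hW, Matrix.one_mul]

lemma uConj_blockEmbed (V : unitaryGroup (Fin r ⊕ Fin (d - 2 * r)) ℂ)
    (A : Matrix (Fin r) (Fin r) ℂ) (B : Matrix (Fin r) (Fin r ⊕ Fin (d - 2 * r)) ℂ)
    (C : Matrix (Fin r ⊕ Fin (d - 2 * r)) (Fin r) ℂ)
    (D : Matrix (Fin r ⊕ Fin (d - 2 * r)) (Fin r ⊕ Fin (d - 2 * r)) ℂ) :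
    uConj (blockEmbed d r V) (fromBlocks A B C D)
      = fromBlocks A (B * V.1ᴴ) (V.1 * C) (uConj V D) := by
  have h : (blockEmbed d r V).1
      = fromBlocks 1 0 0 V.1 := rfl
  simp [uConj, h, fromBlocks_multiply, fromBlocks_conjTranspose]

/-- The spectrum of the Haar average of `rhoNet d r t`. -/
noncomputable def rhoWeight (d r : ℕ) (t : ℝ) : BlockIdx d r → ℝ :=
  Sum.elim (fun _ => (1 - t ^ 2) / r) (fun _ => t ^ 2 / (d - r))

lemma haarAverage_rhoNet (hr : 1 ≤ r) (hrd : 2 * r < d) (t : ℝ) :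
    haarAverage (blockEmbed d r).range (rhoNet d r t)
      = diagonal fun i => (rhoWeight d r t i : ℂ) := by
  have hr0 : (r : ℂ) ≠ 0 := by exact_mod_cast (by omega : r ≠ 0)
  have hd0 : (d : ℂ) - r ≠ 0 := by
    rw [sub_ne_zero]
    exact_mod_cast (by omega : d ≠ r)
  have hw : (diagonal fun i => (rhoWeight d r t i : ℂ))
      = fromBlocks ((((1 - t ^ 2) / r : ℝ) : ℂ) • 1) 0 0 (((t ^ 2 / (d - r) : ℝ) : ℂ) • 1) := by
    rw [smul_one_eq_diagonal, smul_one_eq_diagonal, fromBlocks_diagonal]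
    congr 1
    ext (i | i) <;> rfl
  rw [hw]
  refine haarAverage_eq_of_invariant _ _ ?_ fun K hK => ?_
  · rintro _ ⟨V, rfl⟩
    rw [uConj_blockEmbed, uConj_smul, uConj_matrix_one, Matrix.zero_mul, Matrix.mul_zero]
  · have hK' : ∀ V, uConj (blockEmbed d r V) K = K := fun V => hK _ ⟨V, rfl⟩
    rw [← fromBlocks_toBlocks K] at hK' ⊢
    set K₁₁ := K.toBlocks₁₁
    set K₁₂ := K.toBlocks₁₂
    set K₂₁ := K.toBlocks₂₁
    set K₂₂ := K.toBlocks₂₂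
    simp only [uConj_blockEmbed, fromBlocks_inj] at hK'
    obtain ⟨k, hk⟩ := exists_eq_smul_one_of_uConj_eq fun V => (hK' V).2.2.2
    -- Invariance under `V = -1` makes the off-diagonal blocks vanish.
    have hneg : (-1 : unitaryGroup (Fin r ⊕ Fin (d - 2 * r)) ℂ).1 = -1 := rfl
    have h12 : K₁₂ = 0 := by
      have h := (hK' (-1)).2.1
      have h' : -K₁₂ = K₁₂ := by simpa [hneg] using h
      ext i j
      exact self_eq_neg.mp (congrFun (congrFun h'.symm i) j)
    have h21 : K₂₁ = 0 := by
      have h := (hK' (-1)).2.2.1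
      have h' : -K₂₁ = K₂₁ := by simpa [hneg] using h
      ext i j
      exact self_eq_neg.mp (congrFun (congrFun h'.symm i) j)
    have hcast : ((d - 2 * r : ℕ) : ℂ) = d - 2 * r := by
      rw [Nat.cast_sub hrd.le]
      push_cast
      ring
    rw [h12, h21, hk, rhoNet, fromBlocks_smul]
    simp only [fromBlocks_multiply, trace_fromBlocks_eq_add, trace_smul, Matrix.mul_zero,
      Matrix.zero_mul, add_zero,
      zero_add, smul_mul, Matrix.mul_smul, Matrix.one_mul, Matrix.mul_one, smul_eq_mul, trace_one,
      trace_zero, Fintype.card_sum, Fintype.card_fin, Nat.cast_add, hcast]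
    push_cast
    field_simp
    ring

/-- The indices of the first block of `Fin r ⊕ Fin (d - 2 * r)`. -/
def inlIdx (d r : ℕ) : Finset (Fin r ⊕ Fin (d - 2 * r)) :=
  Finset.univ.map Function.Embedding.inl

lemma card_inlIdx : (inlIdx d r).card = r := by
  simp [inlIdx]

/-- The swap of the first two blocks, a contraction, detects the off-diagonal blocks, in which the
states differ to first order in `t`. -/
lemma le_traceNorm_rhoNet_sub (hr : 1 ≤ r) (t : ℝ) (V : unitaryGroup (Fin r ⊕ Fin (d - 2 * r)) ℂ) :
    2 * (t * √(1 - t ^ 2))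
        * (1 - (r : ℝ)⁻¹ * ∑ i : Fin r, (V.1 (Sum.inl i) (Sum.inl i)).re)
      ≤ traceNorm (rhoNet d r t - uConj (blockEmbed d r V) (rhoNet d r t)) := by
  have hr0 : (r : ℝ) ≠ 0 := by positivity
  set s : ℝ := t * √(1 - t ^ 2)
  set K : Matrix (BlockIdx d r) (BlockIdx d r) ℂ :=
    fromBlocks 0 (fromCols 1 0) (fromRows 1 0) 0 with hKdef
  have hK : (1 - K * Kᴴ).PosSemidef := by
    have h : 1 - K * Kᴴ = diagonal (Sum.elim 0 (Sum.elim 0 1)) := by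
      ext (i | i | i) (j | j | j) <;>
        simp [K, fromBlocks_multiply, fromBlocks_conjTranspose,
          conjTranspose_fromRows_eq_fromCols_conjTranspose,
          conjTranspose_fromCols_eq_fromRows_conjTranspose, fromCols_mul_fromRows,
          one_apply, diagonal_apply]
    rw [h]
    refine PosSemidef.diagonal ?_
    rintro (i | i | i) <;> simp
  have htr : ∀ W : unitaryGroup (Fin r ⊕ Fin (d - 2 * r)) ℂ,
      (K * uConj (blockEmbed d r W) (rhoNet d r t)).trace
        = ((2 * s * ((r : ℝ)⁻¹ *
            ∑ i : Fin r, (W.1 (Sum.inl i) (Sum.inl i)).re) : ℝ) : ℂ) := fun W => by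
    have h1 := trace_fromCols_mul_mul_fromRows 1 (s : ℂ) W.1
    have h2 := trace_fromCols_mul_mul_fromRows (s : ℂ) 1 W.1ᴴ
    rw [one_smul, one_mul] at h1
    rw [one_smul, mul_one, ← Matrix.mul_assoc, trace_mul_comm] at h2
    rw [rhoNet, uConj_smul, uConj_blockEmbed, Matrix.mul_smul, trace_smul, hKdef,
      fromBlocks_multiply, trace_fromBlocks_eq_add]
    simp only [Matrix.zero_mul, zero_add, add_zero]
    rw [h1, h2, ← mul_add, ← Finset.sum_add_distrib]
    simp only [conjTranspose_apply, Complex.star_def, Complex.add_conj, smul_eq_mul]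
    push_cast
    rw [← Finset.mul_sum]
    ring
  have h := norm_trace_mul_le_traceNorm
    (rhoNet d r t - uConj (blockEmbed d r V) (rhoNet d r t)) hK
  have h1 := htr 1
  rw [map_one, uConj_one] at h1
  rw [Matrix.mul_sub, trace_sub, h1, htr V, ← Complex.ofReal_sub, Complex.norm_real] at h
  refine le_of_eq_of_le ?_ ((le_abs_self _).trans h)
  have h2 : ∑ i : Fin r, ((1 : unitaryGroup (Fin r ⊕ Fin (d - 2 * r)) ℂ).1
      (Sum.inl i) (Sum.inl i)).re = r := by simp
  rw [h2, inv_mul_cancel₀ hr0]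
  ring

/-- Packing by rotations of the second and third block. -/
lemma exists_rhoNet_packing (hr : 1 ≤ r) (hrd : (r : ℝ) < d / 3) {t : ℝ} (ht0 : 0 < t)
    (ht : t ≤ 1 / 2) :
    ∃ (N : ℕ) (V : Fin N → unitaryGroup (Fin r ⊕ Fin (d - 2 * r)) ℂ),
      Real.exp (d * r / 54) ≤ N ∧ ∀ i j, i ≠ j →
        t / 4 < traceNorm (uConj (blockEmbed d r (V i)) (rhoNet d r t)
          - uConj (blockEmbed d r (V j)) (rhoNet d r t)) := by
  have hr0 : (0 : ℝ) < r := by exact_mod_cast hr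
  have hrd' : 3 * r < d := by
    have : (3 : ℝ) * r < d := by linarith
    exact_mod_cast this
  have hS : (inlIdx d r).card = r := card_inlIdx
  -- As `2 * √(1 - t²) > 1.72`, distance `t / 4` is guaranteed by `∑ Re V i i < 17 / 20 * r`, which
  -- by Cauchy-Schwarz follows from an overlap below `(17 / 20)² * r`.
  refine exists_orbit_packing (blockEmbed d r) _
    {V | 289 / 400 * r ≤ overlap (inlIdx d r) (inlIdx d r) V} ?_ fun V hV => ?_
  · refine (measure_le_overlap_le _ _ (Finset.card_pos.mp (by rw [hS]; exact hr)) (θ := 1 / 3)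
      (by norm_num) (by norm_num) _).trans ?_
    have hcard : (Fintype.card (Fin r ⊕ Fin (d - 2 * r)) : ℝ) = d - r := by
      rw [Fintype.card_sum, Fintype.card_fin, Fintype.card_fin, Nat.cast_add,
        Nat.cast_sub (by omega)]
      push_cast
      ring
    rw [hS, hcard]
    have h1 : -(42 / 100) ≤ Real.log (1 - 1 / 3) := by
      rw [Real.le_log_iff_exp_le (by norm_num), Real.exp_neg]
      have := Real.quadratic_le_exp_of_nonneg (x := 42 / 100) (by norm_num)
      rw [inv_le_comm₀ (Real.exp_pos _) (by norm_num)]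
      norm_num at this ⊢
      linarith
    gcongr
    have h2 : (r : ℝ) * r * -(42 / 100) ≤ r * r * Real.log (1 - 1 / 3) := by gcongr
    have h3 : (r : ℝ) * r ≤ r * (d / 3) := by gcongr
    nlinarith
  · rw [Set.mem_ofPred_eq, not_le] at hV
    refine lt_of_lt_of_le ?_ (le_traceNorm_rhoNet_sub hr t V)
    set x := ∑ i : Fin r, (V.1 (Sum.inl i) (Sum.inl i)).re
    have hx : x < 17 / 20 * r := by
      refine lt_of_pow_lt_pow_left₀ 2 (by positivity) ?_
      have h1 : x ^ 2 ≤ r * ∑ i : Fin r, (V.1 (Sum.inl i) (Sum.inl i)).re ^ 2 := by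
        have := sq_sum_le_card_mul_sum_sq (s := Finset.univ)
          (f := fun i : Fin r => (V.1 (Sum.inl i) (Sum.inl i)).re)
        simpa using this
      have h2 : ∑ i : Fin r, (V.1 (Sum.inl i) (Sum.inl i)).re ^ 2
          ≤ overlap (inlIdx d r) (inlIdx d r) V := by
        simp only [overlap, colMass, inlIdx, Finset.sum_map, Function.Embedding.inl_apply]
        refine Finset.sum_le_sum fun i _ => ?_
        refine le_trans ?_ (Finset.single_le_sum (f := fun k : Fin r =>
          ‖V.1 (Sum.inl k) (Sum.inl i)‖ ^ 2) (fun _ _ => by positivity)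
          (Finset.mem_univ i))
        rw [← sq_abs]
        gcongr
        exact Complex.abs_re_le_norm _
      nlinarith
    have h1 : (r : ℝ)⁻¹ * x < 17 / 20 := by
      rw [inv_mul_lt_iff₀ hr0]
      linarith
    have h2 : 86 / 100 ≤ √(1 - t ^ 2) := by
      refine Real.le_sqrt_of_sq_le ?_
      nlinarith
    calc t / 4 < 2 * (t * (86 / 100)) * (3 / 20) := by linarith
      _ ≤ 2 * (t * √(1 - t ^ 2)) * (1 - (r : ℝ)⁻¹ * x) := by
          gcongr
          linarith

lemma holevoHaar_rhoNet_le (hr : 1 ≤ r) (hrd : 2 * r < d) {t : ℝ} (ht0 : 0 < t)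
    (ht : t < 1) :
    holevoHaar (blockEmbed d r).range (rhoNet d r t)
      ≤ t ^ 2 * Real.log (Real.exp 1 * d / (t ^ 2 * r)) := by
  have hr0 : (0 : ℝ) < r := by exact_mod_cast hr
  have hd0 : (0 : ℝ) < d - r := by
    rw [sub_pos]
    exact_mod_cast (by omega : r < d)
  have ht2 : 0 < 1 - t ^ 2 := by nlinarith
  rw [holevoHaar, haarAverage_rhoNet hr hrd, vnEntropy_diagonal, vnEntropy_rhoNet hr (by linarith)]
  have hsum : ∑ i, Real.negMulLog (rhoWeight d r t i)
      = r * Real.negMulLog ((1 - t ^ 2) / r) + (d - r) * Real.negMulLog (t ^ 2 / (d - r)) := by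
    have hcast : ((d - 2 * r : ℕ) : ℝ) = d - 2 * r := by
      rw [Nat.cast_sub hrd.le]
      push_cast
      ring
    rw [Fintype.sum_sum_type]
    simp only [rhoWeight, Sum.elim_inl, Sum.elim_inr, Finset.sum_const, Finset.card_univ,
      Fintype.card_sum, Fintype.card_fin, nsmul_eq_mul, Nat.cast_add, hcast]
    ring
  have h1 : r * Real.negMulLog ((1 - t ^ 2) / r)
      = (1 - t ^ 2) * Real.log r - (1 - t ^ 2) * Real.log (1 - t ^ 2) := by
    rw [Real.negMulLog, Real.log_div ht2.ne' hr0.ne']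
    field_simp
    ring
  have h2 : (d - r) * Real.negMulLog (t ^ 2 / (d - r))
      = t ^ 2 * (Real.log (d - r) - Real.log (t ^ 2)) := by
    rw [Real.negMulLog, Real.log_div (by positivity) hd0.ne']
    field_simp
    ring
  have h3 : Real.log (Real.exp 1 * d / (t ^ 2 * r))
      = 1 + Real.log d - Real.log (t ^ 2) - Real.log r := by
    have : (0 : ℝ) < d := by linarith
    rw [Real.log_div (by positivity) (by positivity), Real.log_mul (by positivity) (by positivity),
      Real.log_mul (by positivity) (by positivity), Real.log_exp]
    ring
  have h4 : -((1 - t ^ 2) * Real.log (1 - t ^ 2)) ≤ t ^ 2 := by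
    have h5 := Real.one_sub_inv_le_log_of_pos ht2
    have h6 := mul_le_mul_of_nonneg_left h5 ht2.le
    rw [mul_sub, mul_inv_cancel₀ ht2.ne'] at h6
    linarith
  have h5 : t ^ 2 * Real.log (d - r) ≤ t ^ 2 * Real.log d := by
    gcongr
    linarith
  rw [hsum, h1, h2, h3]
  nlinarith

lemma rhoWeight_pos (hr : 1 ≤ r) (hrd : r < d) {t : ℝ} (ht0 : 0 < t) (ht : t < 1)
    (i : BlockIdx d r) : 0 < rhoWeight d r t i := by
  have hr0 : (0 : ℝ) < r := by exact_mod_cast hr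
  have hd0 : (0 : ℝ) < d - r := sub_pos.mpr (by exact_mod_cast hrd)
  have ht2 : 0 < 1 - t ^ 2 := by nlinarith
  rcases i with i | i <;> simp only [rhoWeight, Sum.elim_inl, Sum.elim_inr] <;> positivity

end Block

/-! ### Change of index set -/

section Reindex

lemma trace_reindex {n m : Type*} [Fintype n] [Fintype m] (e : n ≃ m)
    (A : Matrix n n ℂ) : (reindex e e A).trace = A.trace := by
  simp only [Matrix.trace, diag_apply, reindex_apply, submatrix_apply]
  exact e.symm.sum_comp fun i => A i i

lemma isDensity_reindex {n m : Type*} [Fintype n] [Fintype m] (e : n ≃ m)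
    {ρ : Matrix n n ℂ} (hρ : IsDensity ρ) :
    IsDensity (reindex e e ρ) :=
  ⟨hρ.1.submatrix e.symm, (trace_reindex e ρ).trans hρ.2⟩

variable {n m : Type*} [Fintype n] [DecidableEq n] [Fintype m] [DecidableEq m]

/-- The isomorphism of unitary groups induced by a bijection of index sets, as a homomorphism. -/
def reindexUnitary (e : n ≃ m) : unitaryGroup n ℂ →* unitaryGroup m ℂ where
  toFun U := ⟨reindex e e U.1, by
    have h : U.1 * U.1ᴴ = 1 := Unitary.coe_mul_star_self U
    rw [mem_unitaryGroup_iff, star_eq_conjTranspose, conjTranspose_reindex, reindex_apply,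
      reindex_apply, submatrix_mul_equiv, h, submatrix_one_equiv]⟩
  map_one' := by
    apply Subtype.ext
    simp
  map_mul' U V := by
    apply Subtype.ext
    simp [submatrix_mul_equiv]

lemma uConj_reindexUnitary (e : n ≃ m) (U : unitaryGroup n ℂ) (A : Matrix n n ℂ) :
    uConj (reindexUnitary e U) (reindex e e A) = reindex e e (uConj U A) := by
  have h : (reindexUnitary e U).1 = reindex e e U.1 := rfl
  rw [uConj, uConj, h, conjTranspose_reindex, reindex_apply, reindex_apply, reindex_apply,
    submatrix_mul_equiv, submatrix_mul_equiv, reindex_apply]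

lemma compactSpace_map_reindexUnitary (e : n ≃ m) (G : Subgroup (unitaryGroup n ℂ))
    [hG : CompactSpace G] : CompactSpace (G.map (reindexUnitary e)) := by
  have hc : Continuous (reindexUnitary e) :=
    (continuous_subtype_val.matrix_reindex e e).subtype_mk _
  have h := (isCompact_iff_compactSpace.mpr hG).image hc
  exact isCompact_iff_compactSpace.mp h

lemma haarAverage_reindex (e : n ≃ m) (G : Subgroup (unitaryGroup n ℂ)) [CompactSpace G]
    [CompactSpace (G.map (reindexUnitary e))] (ρ : Matrix n n ℂ) :
    haarAverage (G.map (reindexUnitary e)) (reindex e e ρ) = reindex e e (haarAverage G ρ) := by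
  refine haarAverage_eq_of_invariant _ _ ?_ fun K hK => ?_
  · rintro _ ⟨U, hU, rfl⟩
    rw [uConj_reindexUnitary, uConj_haarAverage G ρ hU]
  · obtain ⟨K, rfl⟩ := (reindex e e).surjective K
    have hK' : ∀ U ∈ G, uConj U K = K := fun U hU =>
      (reindex e e).injective (by rw [← uConj_reindexUnitary, hK _ ⟨U, hU, rfl⟩])
    have hmul : ∀ A : Matrix n n ℂ, reindex e e A * reindex e e K = reindex e e (A * K) :=
      fun A => by
        rw [reindex_apply, reindex_apply, submatrix_mul_equiv, reindex_apply]
    rw [hmul, hmul, trace_reindex, trace_reindex, trace_haarAverage_mul G ρ hK']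

end Reindex

/-! ### The three nets -/

lemma packingNetExists_rhoNet {c : ℝ} (hc : 1000 ≤ c) {d r : ℕ} {ε : ℝ} (hr : 1 ≤ r)
    (hrd : (r : ℝ) < d / 3) (hε0 : 0 < ε) (hε : ε ≤ 1 / 2 ^ 4) :
    PackingNetExists d r ε c (ε ^ 2 * Real.log (d / (r * ε))) (r * d) := by
  have hr0 : (0 : ℝ) < r := by exact_mod_cast hr
  have hd0 : (0 : ℝ) < d := by linarith
  have hrd' : 3 * r < d := by
    have : (3 : ℝ) * r < d := by linarith
    exact_mod_cast this
  have ht0 : 0 < 8 * ε := by positivity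
  have ht : 8 * ε ≤ 1 / 2 := by linarith
  have ht2 : (8 * ε) ^ 2 ≤ 1 := by nlinarith
  obtain ⟨N, V, hN, hV⟩ := exists_rhoNet_packing hr hrd ht0 ht
  have hN0 : 0 < N := by
    have := (Real.exp_pos _).trans_le hN
    exact_mod_cast this
  let e : BlockIdx d r ≃ Fin d := Fintype.equivFinOfCardEq (by
    simp only [Fintype.card_sum, Fintype.card_fin]
    omega)
  set ρ := rhoNet d r (8 * ε)
  have hρ : IsDensity ρ := isDensity_rhoNet hr ht2
  have hcomp : CompactSpace ((blockEmbed d r).range.map (reindexUnitary e)) :=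
    compactSpace_map_reindexUnitary e _
  have havg : haarAverage ((blockEmbed d r).range.map (reindexUnitary e)) (reindex e e ρ)
      = diagonal fun i => (rhoWeight d r (8 * ε) (e.symm i) : ℂ) := by
    rw [haarAverage_reindex, haarAverage_rhoNet hr (by omega), reindex_apply,
      submatrix_diagonal_equiv]
    rfl
  have hχ : holevoHaar ((blockEmbed d r).range.map (reindexUnitary e)) (reindex e e ρ)
      = holevoHaar (blockEmbed d r).range ρ := by
    rw [holevoHaar, holevoHaar, haarAverage_reindex, vnEntropy_reindex e hρ.1.isHermitian,
      vnEntropy_reindex]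
    rw [haarAverage_rhoNet hr (by omega)]
    exact isHermitian_diagonal_of_self_adjoint _ (by ext; simp)
  refine ⟨(blockEmbed d r).range.map (reindexUnitary e), hcomp, reindex e e ρ, N,
    fun i => ⟨reindexUnitary e (blockEmbed d r (V i)), _, ⟨V i, rfl⟩, rfl⟩,
    isDensity_reindex e hρ, by rw [rank_reindex, rank_rhoNet hr ht2], fun i j hij => ?_, ?_, ?_, ?_⟩
  · simp only [uConj_reindexUnitary]
    have h := hV i j hij
    have h2 : reindex e e (uConj (blockEmbed d r (V i)) ρ)
        - reindex e e (uConj (blockEmbed d r (V j)) ρ)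
        = reindex e e (uConj (blockEmbed d r (V i)) ρ - uConj (blockEmbed d r (V j)) ρ) := rfl
    rw [h2, traceNorm_reindex]
    linarith
  · exact holevoInfo_le_holevoHaar _ (isDensity_reindex e hρ)
      (fun i => rhoWeight_pos hr (by omega) ht0 (by linarith) (e.symm i)) havg hN0 _
      fun i => ⟨_, ⟨V i, rfl⟩, rfl⟩
  · rw [hχ, div_le_iff₀ (by linarith)]
    refine (holevoHaar_rhoNet_le hr (by omega) ht0 (by linarith)).trans ?_
    -- The argument of the logarithm is at most the square of `d / (r ε)`, as `e ≤ 64` and `r ≤ d`.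
    have h1 : Real.log (Real.exp 1 * d / ((8 * ε) ^ 2 * r)) ≤ 2 * Real.log (d / (r * ε)) := by
      rw [← Real.log_rpow (by positivity), Real.rpow_two]
      refine Real.log_le_log (by positivity) ?_
      have h2 := Real.exp_one_lt_d9
      rw [div_pow, div_le_div_iff₀ (by positivity) (by positivity)]
      have h3 : Real.exp 1 * r ≤ 64 * d := by nlinarith
      calc Real.exp 1 * d * (r * ε) ^ 2 = (Real.exp 1 * r) * (d * r * ε ^ 2) := by ring
        _ ≤ (64 * d) * (d * r * ε ^ 2) := by gcongr
        _ = d ^ 2 * ((8 * ε) ^ 2 * r) := by ring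
    have h4 : 0 ≤ Real.log (d / (r * ε)) := by
      refine Real.log_nonneg ?_
      rw [one_le_div (by positivity)]
      nlinarith
    calc (8 * ε) ^ 2 * Real.log (Real.exp 1 * d / ((8 * ε) ^ 2 * r))
        ≤ (8 * ε) ^ 2 * (2 * Real.log (d / (r * ε))) := by gcongr
      _ = ε ^ 2 * Real.log (d / (r * ε)) * 128 := by ring
      _ ≤ ε ^ 2 * Real.log (d / (r * ε)) * c := by gcongr; linarith
  · have h1 : (d : ℝ) * r / 54 ≤ Real.log N := (Real.le_log_iff_exp_le (by positivity)).mpr hN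
    have h2 : 0 ≤ (d : ℝ) * r := by positivity
    nlinarith

lemma packingNetExists_tauNet_half {c : ℝ} (hc : 1000 ≤ c) {d : ℕ} {ε : ℝ} (hd1 : 1 ≤ d)
    (hd : Even d) (hε0 : 0 < ε) (hε : ε ≤ 1 / 2 ^ 3) :
    PackingNetExists d d ε c (ε ^ 2) (d ^ 2) := by
  obtain ⟨r, hr2⟩ := hd.two_dvd
  have hr : 1 ≤ r := by omega
  have hr0 : (0 : ℝ) < r := by exact_mod_cast hr
  have hd2 : (d : ℝ) = 2 * r := by rw [hr2]; push_cast; ring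
  have ht0 : 0 < 4 * ε := by positivity
  have ht : 4 * ε ≤ 1 / 2 := by linarith
  obtain ⟨N, U, hN, hU⟩ := exists_tauNet_packing_half hr hr2 ht0
  have hN0 : 0 < N := by
    have := (Real.exp_pos _).trans_le hN
    exact_mod_cast this
  refine ⟨⊤, inferInstance, tauNet d r (4 * ε) 1, N, fun i => ⟨U i, trivial⟩,
    isDensity_tauNet hr (by omega) ht0.le (by linarith), ?_, fun i j hij => ?_,
    holevoInfo_tauNet_le hr (by omega) ht0.le (by linarith) hN0 U, ?_, ?_⟩
  · rw [tauNet_one, rank_diagonal]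
    have h : ∀ i : Fin d, (tauWeight d r (4 * ε) i : ℂ) ≠ 0 := fun i => by
      rw [Complex.ofReal_ne_zero, tauWeight, hd2]
      have h1 : (0 : ℝ) < 2 * r - r := by linarith
      have h2 : 0 < 1 - 4 * ε := by linarith
      split_ifs <;> positivity
    simp [h]
  · have h := hU i j hij
    linarith
  · rw [div_le_iff₀ (by linarith)]
    refine (holevoHaar_tauNet_half hr hr2 ht0.le (by linarith)).trans ?_
    nlinarith [sq_nonneg ε]
  · have h1 : (d : ℝ) ^ 2 / 32 ≤ Real.log N := (Real.le_log_iff_exp_le (by positivity)).mpr hN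
    nlinarith [sq_nonneg (d : ℝ)]

lemma packingNetExists_tauNet_one {c : ℝ} (hc : 1000 ≤ c) {d r : ℕ} {ε : ℝ} (hr : 1 ≤ r)
    (hε0 : 0 < ε) (hε1 : ε < 1) (hrd : (r : ℝ) < d * (1 - ε) / 6) :
    PackingNetExists d r ε c (Real.log (d / r)) (r * d * (1 - ε)) := by
  have hr0 : (0 : ℝ) < r := by exact_mod_cast hr
  have hrd1 : (r : ℝ) < d := by
    have h1 : (d : ℝ) * (1 - ε) ≤ d := mul_le_of_le_one_right (by positivity) (by linarith)
    linarith
  have hrd' : r < d := by exact_mod_cast hrd1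
  obtain ⟨N, U, hN, hU⟩ := exists_tauNet_packing_one hr hε0 hε1 hrd
  have hN0 : 0 < N := by
    have := (Real.exp_pos _).trans_le hN
    exact_mod_cast this
  refine ⟨⊤, inferInstance, tauNet d r 1 1, N, fun i => ⟨U i, trivial⟩,
    isDensity_tauNet hr hrd' zero_le_one le_rfl, ?_, fun i j hij => ?_,
    holevoInfo_tauNet_le hr hrd' zero_le_one le_rfl hN0 U, ?_, ?_⟩
  · rw [tauNet_one, rank_diagonal, Fintype.card_subtype]
    have h : ∀ i : Fin d, (tauWeight d r 1 i : ℂ) ≠ 0 ↔ (i : ℕ) < r := fun i => by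
      rw [Complex.ofReal_ne_zero, tauWeight]
      split_ifs with hi <;> simp [hi, hr0.ne']
    simp only [h]
    exact card_firstIdx hrd'.le
  · have h := hU i j hij
    linarith
  · rw [holevoHaar_tauNet_one hr hrd']
    have h : 0 ≤ Real.log (d / r) := Real.log_nonneg (by rw [one_le_div hr0]; exact hrd1.le)
    exact div_le_self h (by linarith)
  · have h1 : (1 - ε) * r * d / 2 ≤ Real.log N :=
      (Real.le_log_iff_exp_le (by positivity)).mpr hN
    have h2 : 0 ≤ (1 - ε) * r * d := by
      have : 0 < 1 - ε := by linarith
      positivity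
    nlinarith
theorem mainTheorem6 :
    -- The three nets, with any constant `c ≥ 1000`.
    (∀ c : ℝ, 1000 ≤ c →
      (∀ (d r : ℕ) (ε : ℝ), 1 ≤ r → (r : ℝ) < d / 3 → 0 < ε → ε ≤ 1 / 2 ^ 4 →
        PackingNetExists d r ε c (ε ^ 2 * Real.log (d / (r * ε))) (r * d)) ∧
      (∀ (d : ℕ) (ε : ℝ), 1 ≤ d → Even d → 0 < ε → ε ≤ 1 / 2 ^ 3 →
        PackingNetExists d d ε c (ε ^ 2) (d ^ 2)) ∧
      (∀ (d r : ℕ) (ε : ℝ), 1 ≤ r → 0 < ε → ε < 1 → (r : ℝ) < d * (1 - ε) / 6 →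
        PackingNetExists d r ε c (Real.log (d / r)) (r * d * (1 - ε)))) ∧
    -- The family behind net I.
    (∀ (d r : ℕ) (t : ℝ), 1 ≤ r → (r : ℝ) < d / 3 → 0 < t → t < 1 / 2 →
      ∃ (N : ℕ) (U : Fin N → Matrix.unitaryGroup (Fin r ⊕ Fin (d - 2 * r)) ℂ),
        Real.exp (d * r / 54) ≤ N ∧
        (∀ i j, i ≠ j → t / 4 < traceNorm (rhoNetU d r t (U i) - rhoNetU d r t (U j))) ∧
        holevoInfo (fun i => rhoNetU d r t (U i)) ≤
          holevoHaar (blockEmbed d r).range (rhoNet d r t) ∧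
        holevoHaar (blockEmbed d r).range (rhoNet d r t) ≤
          t ^ 2 * Real.log (Real.exp 1 * d / (t ^ 2 * r))) ∧
    -- The family behind net II.
    (∀ (d r : ℕ) (t : ℝ), 1 ≤ r → d = 2 * r → 0 < t → t ≤ 1 →
      ∃ (N : ℕ) (U : Fin N → Matrix.unitaryGroup (Fin d) ℂ),
        Real.exp ((d : ℝ) ^ 2 / 32) ≤ N ∧
        (∀ i j, i ≠ j → t / 2 < traceNorm (tauNet d r t (U i) - tauNet d r t (U j))) ∧
        holevoInfo (fun i => tauNet d r t (U i)) ≤ holevoHaar ⊤ (tauNet d r t 1) ∧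
        holevoHaar ⊤ (tauNet d r t 1) ≤ t ^ 2) ∧
    -- The family behind net III.
    (∀ (d r : ℕ) (ε : ℝ), 1 ≤ r → 0 < ε → ε < 1 → (r : ℝ) < d * (1 - ε) / 6 →
      ∃ (N : ℕ) (U : Fin N → Matrix.unitaryGroup (Fin d) ℂ),
        Real.exp ((1 - ε) * r * d / 2) ≤ N ∧
        (∀ i j, i ≠ j → 2 * ε < traceNorm (tauNet d r 1 (U i) - tauNet d r 1 (U j))) ∧
        holevoInfo (fun i => tauNet d r 1 (U i)) ≤ holevoHaar ⊤ (tauNet d r 1 1) ∧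
        holevoHaar ⊤ (tauNet d r 1 1) ≤ Real.log (d / r)) := by
  refine ⟨fun c hc => ⟨fun d r ε hr hrd hε0 hε => packingNetExists_rhoNet hc hr hrd hε0 hε,
    fun d ε hd1 hd hε0 hε => packingNetExists_tauNet_half hc hd1 hd hε0 hε,
    fun d r ε hr hε0 hε1 hrd => packingNetExists_tauNet_one hc hr hε0 hε1 hrd⟩, ?_, ?_, ?_⟩
  · intro d r t hr hrd ht0 ht
    have hrd' : 3 * r < d := by
      have : (3 : ℝ) * r < d := by linarith
      exact_mod_cast this
    obtain ⟨N, V, hN, hV⟩ := exists_rhoNet_packing hr hrd ht0 ht.le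
    have hN0 : 0 < N := by
      have := (Real.exp_pos _).trans_le hN
      exact_mod_cast this
    exact ⟨N, V, hN, hV, holevoInfo_le_holevoHaar _ (isDensity_rhoNet hr (by nlinarith))
      (rhoWeight_pos hr (by omega) ht0 (by linarith)) (haarAverage_rhoNet hr (by omega) t) hN0
      (fun i => blockEmbed d r (V i)) fun i => ⟨V i, rfl⟩,
      holevoHaar_rhoNet_le hr (by omega) ht0 (by linarith)⟩
  · intro d r t hr hd ht0 ht
    obtain ⟨N, U, hN, hU⟩ := exists_tauNet_packing_half hr hd ht0
    have hN0 : 0 < N := by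
      have := (Real.exp_pos _).trans_le hN
      exact_mod_cast this
    refine ⟨N, U, hN, ?_, ?_, holevoHaar_tauNet_half hr hd ht0.le ht⟩
    · simpa only [tauNet_eq_uConj _ (U _)] using hU
    · simpa only [tauNet_eq_uConj _ (U _)] using
        holevoInfo_tauNet_le hr (by omega) ht0.le ht hN0 U
  · intro d r ε hr hε0 hε1 hrd
    have hrd' : r < d := by
      have h1 : (d : ℝ) * (1 - ε) ≤ d := mul_le_of_le_one_right (by positivity) (by linarith)
      have hr0 : (0 : ℝ) < r := by exact_mod_cast hr
      have h2 : (r : ℝ) < d := by linarith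
      exact_mod_cast h2
    obtain ⟨N, U, hN, hU⟩ := exists_tauNet_packing_one hr hε0 hε1 hrd
    have hN0 : 0 < N := by
      have := (Real.exp_pos _).trans_le hN
      exact_mod_cast this
    refine ⟨N, U, hN, ?_, ?_, (holevoHaar_tauNet_one hr hrd').le⟩
    · simpa only [tauNet_eq_uConj _ (U _)] using hU
    · simpa only [tauNet_eq_uConj _ (U _)] using
        holevoInfo_tauNet_le hr hrd' zero_le_one le_rfl hN0 U
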